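/- Let $\Gamma$ be an arbitrary directed graph with vertex set $\Gamma^0$, edge set $\Gamma^1$ and source and range maps $s,r:\Gamma^1\to\Gamma^0$. Let $C^*(\Gamma)$ be the universal $C^*$-algebra generated by mutually orthogonal projections $p_v$ ($v\in\Gamma^0$) and partial isometries $s_\gamma$ ($\gamma\in\Gamma^1$) such that $s_\gamma^*s_\gamma=p_{r(\gamma)}$; the ranges of the $s_\gamma$ with $s(\gamma)=v$ are mutually orthogonal and dominated by $p_v$; and $\sum_{s(\gamma)=v}s_\gamma s_\gamma^*=p_v$ whenever $s^{-1}(v)$ is finite and non-empty. Let $L(\Gamma)\subseteq C^*(\Gamma)$ be the Leavitt path algebra, i.e. the $*$-subalgebra (without closure) generated by all $p_v$ and $s_\gamma$. Let $G\subseteq\mathbb S^1$ be a closed subgroup with character group $\widehat G$, acting on $B=C^*(\Gamma)$ by the gauge action $\alpha$, i.e. $\alpha_z(p_v)=p_v$ and $\alpha_z(s_\gamma)=z s_\gamma$ for $z\in G$. For $\tau\in\widehat G$ put $B_\tau=\{b\in B:\alpha_z(b)=\tau(z)b\ \text{for all } z\in G\}$ and $L_\tau=L(\Gamma)\cap B_\tau$.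 Then the following are equivalent: 1. the action is free, i.e. the linear span of the functions $z\mapsto a\,\alpha_z(b)$, $a,b\in B$, is norm-dense in $C(G,B)=B\otimes C(G)$; 2. the action is saturated, i.e. for every $\tau\in\widehat G$ the linear span of $B_\tau^*B_\tau$ is dense in the fixed-point algebra $B^G$; 3. the induced $\widehat G$-grading of $L(\Gamma)$ is strong, i.e. $L(\Gamma)=\bigoplus_{\tau\in\widehat G}L_\tau$ and, for all $\tau,\eta\in\widehat G$, the linear span of $L_\tau L_\eta$ equals $L_{\tau\eta}$. -/

import Mathlib

open scoped ENNReal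

universe u v w

/-- A directed graph with vertex set `V`, edge set `E`, and source and range maps `E → V`.
Loops, multiple edges, sinks, sources and infinite emitters are all allowed. -/
structure DirGraph (V : Type u) (E : Type v) where
  src : E → V
  rng : E → V

namespace DirGraph

variable {V : Type u} {E : Type v}

/-- A Cuntz-Krieger family for the graph `Γ` in a C*-algebra: mutually orthogonal projections
`P v` and elements `S e` (partial isometries, since `S e ^* S e` is a projection) such that
`S e ^* S e = P (rng e)`, the ranges of the `S e` with a common source are mutually orthogonal and
lie under `P (src e)`, and `P v = ∑ S e S e ^*` (sum over the edges `e` with source `v`)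
whenever the set of these edges is finite and non-empty. -/
structure IsCKFamily (Γ : DirGraph V E) {A : Type w} [NonUnitalCStarAlgebra A]
    (P : V → A) (S : E → A) : Prop where
  proj : ∀ v, IsStarProjection (P v)
  orthogonal : ∀ v w, v ≠ w → P v * P w = 0
  star_mul_self : ∀ e, star (S e) * S e = P (Γ.rng e)
  ranges_orthogonal : ∀ e f, Γ.src e = Γ.src f → e ≠ f → star (S e) * S f = 0
  range_le : ∀ e, P (Γ.src e) * S e = S e
  sum_ranges : ∀ v, ∀ h : {e | Γ.src e = v}.Finite, {e | Γ.src e = v}.Nonempty →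
    ∑ e ∈ h.toFinset, S e * star (S e) = P v

/-- The class of all Cuntz-Krieger families for `Γ`, in all C*-algebras of the universe of `Γ`
(which contains, up to isomorphism, every C*-algebra generated by such a family). -/
structure CKRep (Γ : DirGraph V E) where
  alg : Type (max u v)
  [inst : NonUnitalCStarAlgebra alg]
  P : V → alg
  S : E → alg
  isCK : Γ.IsCKFamily P S

attribute [instance] CKRep.inst

theorem IsCKFamily.norm_P_le {Γ : DirGraph V E} {A : Type w} [NonUnitalCStarAlgebra A]
    {P : V → A} {S : E → A} (h : Γ.IsCKFamily P S) (v : V) : ‖P v‖ ≤ 1 :=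
  IsStarProjection.norm_le _ (h.proj v)

theorem IsCKFamily.norm_S_le {Γ : DirGraph V E} {A : Type w} [NonUnitalCStarAlgebra A]
    {P : V → A} {S : E → A} (h : Γ.IsCKFamily P S) (e : E) : ‖S e‖ ≤ 1 := by
  have h1 : ‖S e‖ * ‖S e‖ ≤ 1 := by
    rw [← CStarRing.norm_star_mul_self, h.star_mul_self]
    exact h.norm_P_le _
  nlinarith [norm_nonneg (S e)]

/-- Scaling the edge operators by `z` in the circle gives another Cuntz-Krieger family. -/
theorem IsCKFamily.rotate {Γ : DirGraph V E} {A : Type w} [NonUnitalCStarAlgebra A]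
    {P : V → A} {S : E → A} (h : Γ.IsCKFamily P S) (z : Circle) :
    Γ.IsCKFamily P (fun e => (z : ℂ) • S e) where
  proj := h.proj
  orthogonal := h.orthogonal
  star_mul_self e := by
    have hz : star (z : ℂ) * (z : ℂ) = 1 := by
      rw [Complex.star_def, ← Complex.normSq_eq_conj_mul_self]; simp
    rw [star_smul, smul_mul_smul_comm, hz, one_smul, h.star_mul_self]
  ranges_orthogonal e f hs hef := by
    rw [star_smul, smul_mul_smul_comm, h.ranges_orthogonal e f hs hef, smul_zero]
  range_le e := by rw [mul_smul_comm, h.range_le]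
  sum_ranges v hf hne := by
    have hz : (z : ℂ) * star (z : ℂ) = 1 := by
      rw [Complex.star_def, Complex.mul_conj]; simp
    simp_rw [star_smul, smul_mul_smul_comm, hz, one_smul]
    exact h.sum_ranges v hf hne

/-- The rotation by `z` as a map on the class of all Cuntz-Krieger families. -/
def CKRep.rotate {Γ : DirGraph V E} (z : Circle) (π : Γ.CKRep) : Γ.CKRep where
  alg := π.alg
  P := π.P
  S := fun e => (z : ℂ) • π.S e
  isCK := π.isCK.rotate z

noncomputable section

/-- The C*-algebra of bounded tuples indexed by all Cuntz-Krieger families. -/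
abbrev BigProduct (Γ : DirGraph V E) : Type (max (u + 1) (v + 1)) :=
  lp (fun π : Γ.CKRep => π.alg) ∞

/-- The tuple of all vertex projections at `v`. -/
def bigP (Γ : DirGraph V E) (v : V) : Γ.BigProduct :=
  ⟨fun π => π.P v, memℓp_infty ⟨1, by rintro _ ⟨π, rfl⟩; exact π.isCK.norm_P_le v⟩⟩

/-- The tuple of all edge partial isometries at `e`. -/
def bigS (Γ : DirGraph V E) (e : E) : Γ.BigProduct :=
  ⟨fun π => π.S e, memℓp_infty ⟨1, by rintro _ ⟨π, rfl⟩; exact π.isCK.norm_S_le e⟩⟩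

/-- The closed *-subalgebra generated by the tuples of all vertex projections and all edge
partial isometries. -/
def graphSubalgebra (Γ : DirGraph V E) : NonUnitalStarSubalgebra ℂ Γ.BigProduct :=
  (NonUnitalStarAlgebra.adjoin ℂ (Set.range Γ.bigP ∪ Set.range Γ.bigS)).topologicalClosure

instance (Γ : DirGraph V E) : IsClosed (Γ.graphSubalgebra : Set Γ.BigProduct) :=
  NonUnitalStarSubalgebra.isClosed_topologicalClosure _

/-- The graph C*-algebra `C*(Γ)`: the universal C*-algebra generated by a Cuntz-Krieger family
for `Γ` (see `graphCStar_universal`). -/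
def GraphCStar (Γ : DirGraph V E) : Type (max (u + 1) (v + 1)) := Γ.graphSubalgebra

instance (Γ : DirGraph V E) : NonUnitalCStarAlgebra Γ.GraphCStar :=
  inferInstanceAs (NonUnitalCStarAlgebra Γ.graphSubalgebra)

/-- The vertex projection `p_v` of `C*(Γ)`. -/
def p (Γ : DirGraph V E) (v : V) : Γ.GraphCStar :=
  ⟨Γ.bigP v, NonUnitalStarSubalgebra.le_topologicalClosure _
    (NonUnitalStarAlgebra.subset_adjoin ℂ _ (Or.inl ⟨v, rfl⟩))⟩

/-- The edge partial isometry `s_e` of `C*(Γ)`. -/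
def s (Γ : DirGraph V E) (e : E) : Γ.GraphCStar :=
  ⟨Γ.bigS e, NonUnitalStarSubalgebra.le_topologicalClosure _
    (NonUnitalStarAlgebra.subset_adjoin ℂ _ (Or.inr ⟨e, rfl⟩))⟩

/-- The coordinate *-homomorphism of `C*(Γ)` belonging to a Cuntz-Krieger family. -/
def coord (Γ : DirGraph V E) (π : Γ.CKRep) : Γ.GraphCStar →⋆ₙₐ[ℂ] π.alg where
  toFun x := x.1 π
  map_smul' _ _ := rfl
  map_zero' := rfl
  map_add' _ _ := rfl
  map_mul' _ _ := rfl
  map_star' _ := rfl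

theorem coord_ext {Γ : DirGraph V E} {x y : Γ.GraphCStar}
    (h : ∀ π, Γ.coord π x = Γ.coord π y) : x = y :=
  Subtype.ext (Subtype.ext (funext h))

@[simp] theorem coord_p (Γ : DirGraph V E) (π : Γ.CKRep) (v : V) :
    Γ.coord π (Γ.p v) = π.P v := rfl

@[simp] theorem coord_s (Γ : DirGraph V E) (π : Γ.CKRep) (e : E) :
    Γ.coord π (Γ.s e) = π.S e := rfl

/-- The canonical generators of `C*(Γ)` form a Cuntz-Krieger family. -/
theorem isCKFamily_graphCStar (Γ : DirGraph V E) : Γ.IsCKFamily Γ.p Γ.s where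
  proj v := ⟨coord_ext fun π => by
      rw [map_mul, coord_p]; exact (π.isCK.proj v).isIdempotentElem,
    coord_ext fun π => by
      rw [map_star, coord_p]; exact (π.isCK.proj v).isSelfAdjoint⟩
  orthogonal v w hvw := coord_ext fun π => by simpa using π.isCK.orthogonal v w hvw
  star_mul_self e := coord_ext fun π => by
    simpa [map_star] using π.isCK.star_mul_self e
  ranges_orthogonal e f hs hef := coord_ext fun π => by
    simpa [map_star] using π.isCK.ranges_orthogonal e f hs hef
  range_le e := coord_ext fun π => by simpa using π.isCK.range_le e
  sum_ranges v hf hne := coord_ext fun π => by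
    simpa [map_star, map_sum] using π.isCK.sum_ranges v hf hne

/-- The Leavitt path algebra `L(Γ)`: the *-subalgebra of `C*(Γ)` generated by all vertex
projections and all edge partial isometries. -/
def leavitt (Γ : DirGraph V E) : NonUnitalStarSubalgebra ℂ Γ.GraphCStar :=
  NonUnitalStarAlgebra.adjoin ℂ (Set.range Γ.p ∪ Set.range Γ.s)

/-- The inclusion of `C*(Γ)` in the product. -/
def incl (Γ : DirGraph V E) : Γ.GraphCStar →⋆ₙₐ[ℂ] Γ.BigProduct :=
  NonUnitalStarSubalgebraClass.subtype Γ.graphSubalgebra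

theorem map_leavitt (Γ : DirGraph V E) : Γ.leavitt.map Γ.incl =
    NonUnitalStarAlgebra.adjoin ℂ (Set.range Γ.bigP ∪ Set.range Γ.bigS) := by
  rw [leavitt, NonUnitalStarAlgHom.map_adjoin, Set.image_union, ← Set.range_comp, ← Set.range_comp]
  rfl

/-- `L(Γ)` is dense in `C*(Γ)`. -/
theorem dense_leavitt (Γ : DirGraph V E) : Dense (Γ.leavitt : Set Γ.GraphCStar) := by
  intro x
  have hx : (x.1 : Γ.BigProduct) ∈ closure (Γ.incl '' (Γ.leavitt : Set Γ.GraphCStar)) := by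
    have h2 : (Γ.incl '' (Γ.leavitt : Set Γ.GraphCStar)) =
        (NonUnitalStarAlgebra.adjoin ℂ (Set.range Γ.bigP ∪ Set.range Γ.bigS) :
          Set Γ.BigProduct) := by
      rw [← map_leavitt]; rfl
    rw [h2]; exact x.2
  exact (Topology.IsInducing.closure_eq_preimage_closure_image
    (f := Γ.incl) ⟨rfl⟩ (Γ.leavitt : Set Γ.GraphCStar)).symm ▸ hx

theorem continuous_starHom {A : Type*} {B : Type*} [NonUnitalCStarAlgebra A]
    [NonUnitalCStarAlgebra B] (χ : A →⋆ₙₐ[ℂ] B) : Continuous χ :=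
  AddMonoidHomClass.continuous_of_bound χ 1 fun x => by
    simpa using NonUnitalStarAlgHom.norm_apply_le χ x

/-- *-homomorphisms on `C*(Γ)` that agree on the generators are equal. -/
theorem graphCStar_hom_ext {Γ : DirGraph V E} {A : Type*} [NonUnitalCStarAlgebra A]
    {φ ψ : Γ.GraphCStar →⋆ₙₐ[ℂ] A} (hp : ∀ v, φ (Γ.p v) = ψ (Γ.p v))
    (hs : ∀ e, φ (Γ.s e) = ψ (Γ.s e)) : φ = ψ := by
  refine DFunLike.coe_injective (Continuous.ext_on Γ.dense_leavitt
    (continuous_starHom φ) (continuous_starHom ψ) fun x hx => ?_)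
  refine NonUnitalStarAlgebra.adjoin_le (S := NonUnitalStarAlgHom.equalizer φ ψ) ?_ hx
  rintro _ (⟨v, rfl⟩ | ⟨e, rfl⟩)
  · exact hp v
  · exact hs e

/-- The universal property of `C*(Γ)`. -/
theorem graphCStar_universal (Γ : DirGraph V E) (A : Type (max u v)) [NonUnitalCStarAlgebra A]
    (P : V → A) (S : E → A) (h : Γ.IsCKFamily P S) :
    ∃! φ : Γ.GraphCStar →⋆ₙₐ[ℂ] A, (∀ v, φ (Γ.p v) = P v) ∧ (∀ e, φ (Γ.s e) = S e) :=
  ⟨Γ.coord ⟨A, P, S, h⟩, ⟨fun _ => rfl, fun _ => rfl⟩, fun _ hφ =>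
    graphCStar_hom_ext (fun v => hφ.1 v) (fun e => hφ.2 e)⟩

/-- Relabelling of tuples: `(x_π)_π ↦ (x_{z π})_π`. -/
def bigGauge (Γ : DirGraph V E) (z : Circle) : Γ.BigProduct →⋆ₙₐ[ℂ] Γ.BigProduct where
  toFun x := ⟨fun π => x (π.rotate z), memℓp_infty (by
    obtain ⟨C, hC⟩ := memℓp_infty_iff.1 x.2
    exact ⟨C, by rintro _ ⟨π, rfl⟩; exact hC ⟨π.rotate z, rfl⟩⟩)⟩
  map_smul' _ _ := rfl
  map_zero' := rfl
  map_add' _ _ := rfl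
  map_mul' _ _ := rfl
  map_star' _ := rfl

theorem bigGauge_mem (Γ : DirGraph V E) (z : Circle) (x : Γ.BigProduct)
    (hx : x ∈ Γ.graphSubalgebra) : Γ.bigGauge z x ∈ Γ.graphSubalgebra := by
  have hle : Γ.graphSubalgebra ≤ Γ.graphSubalgebra.comap (Γ.bigGauge z) := by
    refine NonUnitalStarSubalgebra.topologicalClosure_minimal _ ?_
      (IsClosed.preimage (t := (Γ.graphSubalgebra : Set Γ.BigProduct))
        (continuous_starHom (Γ.bigGauge z)) inferInstance)
    refine NonUnitalStarAlgebra.adjoin_le ?_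
    rintro _ (⟨v, rfl⟩ | ⟨e, rfl⟩)
    · exact (Γ.p v).2
    · exact Γ.graphSubalgebra.smul_mem' (z : ℂ) (Γ.s e).2
  exact hle hx

/-- The gauge endomorphism of `C*(Γ)` at `z`. -/
def gaugeHom (Γ : DirGraph V E) (z : Circle) : Γ.GraphCStar →⋆ₙₐ[ℂ] Γ.GraphCStar where
  toFun x := ⟨Γ.bigGauge z x.1, Γ.bigGauge_mem z x.1 x.2⟩
  map_smul' _ _ := rfl
  map_zero' := rfl
  map_add' _ _ := rfl
  map_mul' _ _ := rfl
  map_star' _ := rfl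

@[simp] theorem gaugeHom_p (Γ : DirGraph V E) (z : Circle) (v : V) :
    Γ.gaugeHom z (Γ.p v) = Γ.p v := rfl

@[simp] theorem gaugeHom_s (Γ : DirGraph V E) (z : Circle) (e : E) :
    Γ.gaugeHom z (Γ.s e) = (z : ℂ) • Γ.s e := rfl

theorem gaugeHom_mul (Γ : DirGraph V E) (z w : Circle) (x : Γ.GraphCStar) :
    Γ.gaugeHom (z * w) x = Γ.gaugeHom z (Γ.gaugeHom w x) := by
  refine DFunLike.congr_fun (f := Γ.gaugeHom (z * w))
    (g := (Γ.gaugeHom z).comp (Γ.gaugeHom w)) (graphCStar_hom_ext ?_ ?_) x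
  · intro v; simp
  · intro e; simp [map_smul, smul_smul, mul_comm]

theorem gaugeHom_one (Γ : DirGraph V E) (x : Γ.GraphCStar) : Γ.gaugeHom 1 x = x := by
  refine DFunLike.congr_fun (f := Γ.gaugeHom 1)
    (g := NonUnitalStarAlgHom.id ℂ Γ.GraphCStar) (graphCStar_hom_ext ?_ ?_) x
  · intro v; simp
  · intro e; simp

/-- The full gauge action: `z` in the circle fixes every `p_v` and scales every `s_e` by `z`. -/
def gauge (Γ : DirGraph V E) : Circle →* (Γ.GraphCStar ≃⋆ₐ[ℂ] Γ.GraphCStar) where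
  toFun z :=
    { toFun := Γ.gaugeHom z
      invFun := Γ.gaugeHom z⁻¹
      left_inv := fun x => by rw [← gaugeHom_mul, inv_mul_cancel, gaugeHom_one]
      right_inv := fun x => by rw [← gaugeHom_mul, mul_inv_cancel, gaugeHom_one]
      map_mul' := map_mul (Γ.gaugeHom z)
      map_add' := map_add (Γ.gaugeHom z)
      map_star' := map_star (Γ.gaugeHom z)
      map_smul' := map_smul (Γ.gaugeHom z) }
  map_one' := StarAlgEquiv.ext fun x => Γ.gaugeHom_one x
  map_mul' z w := StarAlgEquiv.ext fun x => Γ.gaugeHom_mul z w x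

theorem continuous_gauge (Γ : DirGraph V E) (x : Γ.GraphCStar) :
    Continuous fun z : Circle => Γ.gauge z x := by
  have hL : ∀ y ∈ Γ.leavitt, Continuous fun z : Circle => Γ.gaugeHom z y := by
    intro y hy
    induction hy using NonUnitalStarAlgebra.adjoin_induction with
    | mem y hy =>
      rcases hy with ⟨v, rfl⟩ | ⟨e, rfl⟩
      · simpa using continuous_const
      · simp only [gaugeHom_s]
        exact Continuous.smul continuous_subtype_val continuous_const
    | add a b _ _ ha hb => simp only [map_add]; exact ha.add hb
    | zero => simpa only [map_zero] using continuous_const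
    | mul a b _ _ ha hb => simp only [map_mul]; exact ha.mul hb
    | smul c a _ ha => simp only [map_smul]; exact ha.const_smul c
    | star a _ ha => simp only [map_star]; exact ha.star
  refine continuous_iff_continuousAt.2 fun z => Metric.continuousAt_iff'.2 fun ε hε => ?_
  obtain ⟨y, hyL, hy⟩ := Metric.mem_closure_iff.1 (Γ.dense_leavitt x) (ε / 3) (by positivity)
  have hd : ∀ w : Circle, dist (Γ.gaugeHom w x) (Γ.gaugeHom w y) < ε / 3 := fun w => by
    rw [dist_eq_norm, ← map_sub]
    exact (NonUnitalStarAlgHom.norm_apply_le _ _).trans_lt (by rwa [← dist_eq_norm])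
  filter_upwards [Metric.continuousAt_iff'.1 (hL y hyL).continuousAt (ε / 3) (by positivity)]
    with w hw
  change dist (Γ.gaugeHom w x) (Γ.gaugeHom z x) < ε
  have h1 := dist_triangle4 (Γ.gaugeHom w x) (Γ.gaugeHom w y) (Γ.gaugeHom z y) (Γ.gaugeHom z x)
  have h2 := hd z
  rw [dist_comm] at h2
  linarith [hd w]

end

end DirGraph

/-- A strongly continuous action of a topological group `G` on a C*-algebra `A` by
*-automorphisms. -/
structure CStarAction (G : Type*) [Group G] [TopologicalSpace G] (A : Type*)
    [NonUnitalCStarAlgebra A] where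
  toHom : G →* (A ≃⋆ₐ[ℂ] A)
  continuous_apply : ∀ a, Continuous fun g => toHom g a

namespace CStarAction

noncomputable section

variable {G : Type*} [CommGroup G] [TopologicalSpace G] {A : Type*} [NonUnitalCStarAlgebra A]

/-- The action as a coaction `ρ : A → A ⊗ C(G) = C(G, A)`, `ρ(a)(g) = g a`. -/
def coaction (α : CStarAction G A) (a : A) : C(G, A) :=
  ⟨fun g => α.toHom g a, α.continuous_apply a⟩

/-- The action is free if the linear map `A ⊗ A → A ⊗ C(G) = C(G, A)`,
`a ⊗ b ↦ (a ⊗ 1) ρ(b)`, has dense range. -/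
def IsFree (α : CStarAction G A) : Prop :=
  Dense (Submodule.span ℂ
    (Set.range fun x : A × A => ContinuousMap.const G x.1 * α.coaction x.2) : Set C(G, A))

/-- The `τ`-eigenspace `{a | g a = τ(g) a for all g}` of a character `τ` of `G`. -/
def eigenspace (α : CStarAction G A) (τ : PontryaginDual G) : Submodule ℂ A where
  carrier := {a | ∀ g, α.toHom g a = ((τ g : Circle) : ℂ) • a}
  add_mem' ha hb g := by rw [map_add, ha g, hb g, smul_add]
  zero_mem' g := by rw [map_zero, smul_zero]
  smul_mem' c a ha g := by rw [map_smul, ha g, smul_comm]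

/-- The action is saturated if for all characters `τ` the linear span of the products `a^* b`,
with `a` and `b` in the `τ`-eigenspace, is dense in the fixed-point algebra. -/
def IsSaturated (α : CStarAction G A) : Prop :=
  ∀ τ : PontryaginDual G,
    closure (Submodule.span ℂ (Set.image2 (fun a b => star a * b)
      (α.eigenspace τ : Set A) (α.eigenspace τ : Set A)) : Set A) =
    {a | ∀ g, α.toHom g a = a}

/-- The restriction of an action to a subgroup. -/
def restrict (α : CStarAction G A) (H : Subgroup G) : CStarAction H A where
  toHom := α.toHom.comp H.subtype
  continuous_apply a := (α.continuous_apply a).comp continuous_subtype_val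

end

end CStarAction

/-- A family of subspaces `(L_τ)` of an algebra `L`, indexed by a group, is a strong grading if
`L` is the direct sum of the `L_τ` and, for all `τ` and `η`, the linear span `L_τ L_η` of the
products is equal to `L_{τ η}`. -/
structure IsStrongGrading {I : Type*} [Group I] {L : Type*} [NonUnitalRing L] [Module ℂ L]
    (M : I → Submodule ℂ L) : Prop where
  independent : iSupIndep M
  iSup_eq_top : ⨆ τ, M τ = ⊤
  span_mul : ∀ τ η, Submodule.span ℂ (Set.image2 (fun a b => a * b) (M τ : Set L) (M η : Set L)) =
    M (τ * η)

namespace DirGraph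

noncomputable section

variable {V : Type u} {E : Type v}

/-- The gauge action of a subgroup `G` of the circle on `C*(Γ)`. -/
def gaugeAction (Γ : DirGraph V E) (G : Subgroup Circle) : CStarAction G Γ.GraphCStar :=
  CStarAction.restrict ⟨Γ.gauge, Γ.continuous_gauge⟩ G

/-- The grading of `L(Γ)` by the characters of `G` that the gauge action of `G` induces:
the component of degree `τ` consists of the `x` in `L(Γ)` with `g x = τ(g) x` for all `g`. -/
def leavittGrading (Γ : DirGraph V E) (G : Subgroup Circle) (τ : PontryaginDual G) :
    Submodule ℂ Γ.leavitt :=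
  ((Γ.gaugeAction G).eigenspace τ).comap
    (NonUnitalStarSubalgebraClass.subtype Γ.leavitt : Γ.leavitt →ₗ[ℂ] Γ.GraphCStar)

end

end DirGraph

/-! All three conditions are tied to one: every vertex projection `p_v` lies in the span of `L_{τ⁻¹}
L_τ`, for every `τ`. The proof runs free ⟹ saturated ⟹ this condition ⟹ strong ⟹ this condition ⟹
free.

Let `E_τ` be the projection of `B` onto `B_τ` obtained by averaging against Haar measure. If the
action is free and `b` is fixed, approximate `g ↦ τ(g) b` by sums of `g ↦ a α_g(c)`. Averaging
against `τ⁻¹` and then applying `E_1` gives back `b` on one side and sums of `E_{τ⁻¹}(a) E_τ(c)` on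
the other, so the action is saturated (`IsFree.isSaturated`).

The heart is the passage from closures to algebra (`p_mem_leavittMul_of_isSaturated`). Saturation
only places `p_v` in the closure of `L_{τ⁻¹} L_τ`. Averaging over the full circle, even when `G` is
smaller, moves the approximants into the span of the monomials `s_μ p_w s_ν^*` with `|μ| = |ν|`.
Each element of this span lies in a finite-dimensional algebra of such monomials. An element `y =
p_v y` of it with `‖p_v - y‖ < 1` therefore has `y w = p_v` for some `w` in the algebra, and
`L_{τ⁻¹} L_τ` absorbs `w`.

Conversely, vertex projections are local units: each monomial satisfies `x = x p_u` for some `u`.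
Inserting `p_u ∈ L_{η⁻¹} L_η` into a monomial of degree `τη` gives strong grading. Writing `p_u = ∑
a b` with `b ∈ L_τ` gives `τ(g) x = ∑ x a α_g(b)`, and freeness follows by Stone–Weierstrass. -/

/-! ### Elementary tensors in `C(X, A)` -/

/-- On a compact Hausdorff space, a closed subspace of the continuous functions with values in a
normed space that contains all elementary tensors is everything. -/
theorem ContinuousMap.eq_top_of_smul_const_mem {X A : Type*} [TopologicalSpace X] [CompactSpace X]
    [T2Space X] [NormedAddCommGroup A] [NormedSpace ℂ A] (M : Submodule ℂ C(X, A))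
    (hM : IsClosed (M : Set C(X, A)))
    (h : ∀ (φ : C(X, ℂ)) (a : A), φ • ContinuousMap.const X a ∈ M) : M = ⊤ := by
  refine (Submodule.eq_top_iff').2 fun f => ?_
  change f ∈ (M : Set C(X, A))
  rw [← hM.closure_eq, Metric.mem_closure_iff]
  intro ε hε
  -- The approximant is `∑ ρ_i ⊗ f(x_i)`, for a partition of unity subordinate to sets on which `f`
  -- stays within `ε / 2` of its value at `x_i`.
  let U : X → Set X := fun x => {y | ‖f y - f x‖ < ε / 2}
  have hU : ∀ x, IsOpen (U x) := fun x =>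
    isOpen_lt (by fun_prop) continuous_const
  obtain ⟨t, ht⟩ := isCompact_univ.elim_finite_subcover U hU fun x _ =>
    Set.mem_iUnion.2 ⟨x, by simpa [U] using half_pos hε⟩
  obtain ⟨ρ, hρ⟩ := PartitionOfUnity.exists_isSubordinate (ι := t) isClosed_univ
    (fun i => U i) (fun i => hU i) (fun x hx => by
      obtain ⟨i, hi, hxi⟩ := Set.mem_iUnion₂.1 (ht hx)
      exact Set.mem_iUnion.2 ⟨⟨i, hi⟩, hxi⟩)
  let c : t → C(X, ℂ) := fun i => ⟨fun x => ((ρ i x : ℝ) : ℂ), by fun_prop⟩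
  refine ⟨∑ i, c i • ContinuousMap.const X (f i), M.sum_mem fun i _ => h _ _, ?_⟩
  refine lt_of_le_of_lt ((ContinuousMap.dist_le (half_pos hε).le).2 fun x => ?_) (half_lt_self hε)
  have hsum : ∑ i, ρ i x = 1 := by
    rw [← finsum_eq_sum_of_fintype]; exact ρ.sum_eq_one (Set.mem_univ x)
  have hsumC : ∑ i, ((ρ i x : ℝ) : ℂ) = 1 := by rw [← Complex.ofReal_sum, hsum]; simp
  have hx : f x - (∑ i, c i • ContinuousMap.const X (f i)) x =
      ∑ i, ((ρ i x : ℝ) : ℂ) • (f x - f i) := by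
    simp only [smul_sub, Finset.sum_sub_distrib, ← Finset.sum_smul, hsumC, one_smul]
    simp [c, ContinuousMap.sum_apply]
  rw [dist_eq_norm, hx]
  calc ‖∑ i, ((ρ i x : ℝ) : ℂ) • (f x - f i)‖ ≤ ∑ i, ρ i x * (ε / 2) := by
        refine norm_sum_le_of_le _ fun i _ => ?_
        rw [norm_smul, Complex.norm_real, Real.norm_of_nonneg (ρ.nonneg i x)]
        by_cases h0 : ρ i x = 0
        · simp [h0]
        · have hxi : x ∈ U i := hρ i (subset_tsupport _ h0)
          exact mul_le_mul_of_nonneg_left (le_of_lt hxi) (ρ.nonneg i x)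
    _ = ε / 2 := by rw [← Finset.sum_mul, hsum, one_mul]

/-- The elementary tensor `φ ⊗ a` as the function `x ↦ φ(x) a`, bilinearly. -/
noncomputable def ContinuousMap.smulConst (X A : Type*) [TopologicalSpace X] [CompactSpace X]
    [NormedAddCommGroup A] [NormedSpace ℂ A] : C(X, ℂ) →L[ℂ] A →L[ℂ] C(X, A) :=
  LinearMap.mkContinuous₂
    (LinearMap.mk₂ ℂ (fun (φ : C(X, ℂ)) (a : A) => φ • ContinuousMap.const X a)
      (fun φ ψ a => add_smul φ ψ _)
      (fun c φ a => by ext x; exact smul_assoc c (φ x) a)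
      (fun φ a b => by ext x; exact smul_add (φ x) a b)
      (fun c φ a => by ext x; exact smul_comm (φ x) c a)) 1 fun φ a => by
    refine (ContinuousMap.norm_le _ (by positivity)).2 fun x => ?_
    change ‖φ x • a‖ ≤ _
    rw [norm_smul, one_mul]
    exact mul_le_mul_of_nonneg_right (φ.norm_coe_le_norm x) (norm_nonneg a)

/-! ### Characters and Stone–Weierstrass -/

namespace PontryaginDual

noncomputable section

variable {G : Type*} [CommGroup G] [TopologicalSpace G]

/-- A character as a complex-valued continuous function. -/
def toContinuousMap (τ : PontryaginDual G) : C(G, ℂ) :=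
  ⟨fun g => ((τ g : Circle) : ℂ), continuous_subtype_val.comp (map_continuous τ)⟩

theorem mul_apply (τ η : PontryaginDual G) (g : G) : (τ * η) g = τ g * η g := rfl

theorem inv_apply (τ : PontryaginDual G) (g : G) : τ⁻¹ g = (τ g)⁻¹ := rfl

theorem pow_apply (τ : PontryaginDual G) (n : ℕ) (g : G) : (τ ^ n) g = τ g ^ n := by
  induction n with
  | zero => rfl
  | succ n ih => rw [pow_succ, pow_succ, mul_apply, ih]

/-- If the characters of a compact group separate points, then they span a dense subspace of the
continuous functions. -/
theorem span_range_toContinuousMap_closure [CompactSpace G]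
    (hsep : ∀ g h : G, g ≠ h → ∃ τ : PontryaginDual G, τ g ≠ τ h) :
    (Submodule.span ℂ (Set.range (toContinuousMap (G := G)))).topologicalClosure = ⊤ := by
  let S : Submonoid C(G, ℂ) :=
    { carrier := Set.range (toContinuousMap (G := G))
      one_mem' := ⟨1, rfl⟩
      mul_mem' := by
        rintro _ _ ⟨τ, rfl⟩ ⟨η, rfl⟩
        exact ⟨τ * η, by ext g; simp [toContinuousMap, mul_apply]⟩ }
  have hS : Submonoid.closure (Set.range (toContinuousMap (G := G))) = S :=
    Submonoid.closure_eq S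
  have hstar : star (Set.range (toContinuousMap (G := G))) ⊆
      Set.range (toContinuousMap (G := G)) := by
    rintro f ⟨τ, hτ⟩
    refine ⟨τ⁻¹, ?_⟩
    rw [← star_star f, ← hτ]
    ext g
    change ((τ⁻¹ g : Circle) : ℂ) = _
    rw [inv_apply, Circle.coe_inv_eq_conj]
    rfl
  -- Characters are closed under products and conjugation, so the star-algebra they generate is just
  -- their linear span.
  have hadj : Subalgebra.toSubmodule
      (StarAlgebra.adjoin ℂ (Set.range (toContinuousMap (G := G)))).toSubalgebra =
      Submodule.span ℂ (Set.range (toContinuousMap (G := G))) := by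
    rw [StarAlgebra.adjoin_toSubalgebra, Set.union_eq_left.2 hstar, Algebra.adjoin_eq_span, hS]
    rfl
  have htop := ContinuousMap.starSubalgebra_topologicalClosure_eq_top_of_separatesPoints
    (StarAlgebra.adjoin ℂ (Set.range (toContinuousMap (G := G)))) (by
      intro g h hgh
      obtain ⟨τ, hτ⟩ := hsep g h hgh
      exact ⟨_, ⟨toContinuousMap τ, StarAlgebra.subset_adjoin ℂ _ ⟨τ, rfl⟩, rfl⟩,
        fun h => hτ (Circle.ext h)⟩)
  rw [Submodule.eq_top_iff']
  intro f
  have hf : f ∈ (StarAlgebra.adjoin ℂ (Set.range (toContinuousMap (G := G)))).topologicalClosure :=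
    htop ▸ trivial
  rw [← hadj]
  exact hf

end

end PontryaginDual

/-! ### Eigenspaces and spectral projections of a compact group action -/

namespace CStarAction

noncomputable section

open MeasureTheory

variable {G : Type*} [CommGroup G] [TopologicalSpace G] {A : Type*} [NonUnitalCStarAlgebra A]

theorem mem_eigenspace {α : CStarAction G A} {τ : PontryaginDual G} {a : A} :
    a ∈ α.eigenspace τ ↔ ∀ g, α.toHom g a = ((τ g : Circle) : ℂ) • a := Iff.rfl

theorem mem_eigenspace_one {α : CStarAction G A} {a : A} :
    a ∈ α.eigenspace 1 ↔ ∀ g, α.toHom g a = a := by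
  simp [mem_eigenspace]

theorem mul_mem_eigenspace {α : CStarAction G A} {τ η : PontryaginDual G} {a b : A}
    (ha : a ∈ α.eigenspace τ) (hb : b ∈ α.eigenspace η) : a * b ∈ α.eigenspace (τ * η) := by
  intro g
  rw [map_mul, ha g, hb g, smul_mul_smul_comm, PontryaginDual.mul_apply, Circle.coe_mul]

theorem star_mem_eigenspace {α : CStarAction G A} {τ : PontryaginDual G} {a : A}
    (ha : a ∈ α.eigenspace τ) : star a ∈ α.eigenspace τ⁻¹ := by
  intro g
  rw [map_star, ha g, star_smul, PontryaginDual.inv_apply, Circle.coe_inv_eq_conj]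
  rfl

theorem eq_zero_of_mem_eigenspace_of_ne {α : CStarAction G A} {τ η : PontryaginDual G}
    (hne : τ ≠ η) {a : A} (ha : a ∈ α.eigenspace τ) (ha' : a ∈ α.eigenspace η) : a = 0 := by
  by_contra h0
  exact hne (PontryaginDual.ext fun g => Circle.ext
    (smul_left_injective ℂ h0 ((ha g).symm.trans (ha' g))))

theorem norm_toHom_apply_le (α : CStarAction G A) (g : G) (a : A) : ‖α.toHom g a‖ ≤ ‖a‖ :=
  NonUnitalStarAlgHom.norm_apply_le (α.toHom g) a

/-- The action of one group element as a continuous linear map. -/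
def toCLM (α : CStarAction G A) (g : G) : A →L[ℂ] A :=
  LinearMap.mkContinuous
    { toFun := α.toHom g, map_add' := map_add _, map_smul' := fun c a => map_smul (α.toHom g) c a }
    1 fun a => by simpa using α.norm_toHom_apply_le g a

theorem span_star_mul_le (α : CStarAction G A) (τ : PontryaginDual G) :
    Submodule.span ℂ (Set.image2 (fun a b => star a * b)
      (α.eigenspace τ : Set A) (α.eigenspace τ : Set A)) ≤ α.eigenspace 1 := by
  refine Submodule.span_le.2 ?_
  rintro _ ⟨a, ha, b, hb, rfl⟩
  simpa using mul_mem_eigenspace (star_mem_eigenspace ha) hb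

theorem isClosed_eigenspace (α : CStarAction G A) (τ : PontryaginDual G) :
    IsClosed (α.eigenspace τ : Set A) := by
  have : (α.eigenspace τ : Set A) = ⋂ g, {a | α.toCLM g a = ((τ g : Circle) : ℂ) • a} := by
    ext a; simp only [Set.mem_iInter]; rfl
  rw [this]
  exact isClosed_iInter fun g =>
    isClosed_eq (α.toCLM g).continuous (continuous_const_smul _)

section Projection

variable [CompactSpace G]

/-- The orbit map is bounded linear. -/
def coactionCLM (α : CStarAction G A) : A →L[ℂ] C(G, A) :=
  LinearMap.mkContinuous
    { toFun := α.coaction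
      map_add' := fun a b => by ext g; exact map_add (α.toHom g) a b
      map_smul' := fun c a => by ext g; exact map_smul (α.toHom g) c a }
    1 fun a => by
      rw [one_mul]
      exact (ContinuousMap.norm_le _ (norm_nonneg a)).2 fun g => α.norm_toHom_apply_le g a

variable [MeasurableSpace G] [BorelSpace G] (μ : Measure G) [IsProbabilityMeasure μ]

theorem integrable_char_smul (τ : PontryaginDual G) (f : C(G, A)) :
    Integrable (fun g => ((τ g : Circle) : ℂ) • f g) μ :=
  (τ.toContinuousMap • f).continuous.integrable_of_hasCompactSupport (.of_compactSpace _)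

/-- The twisted average `f ↦ ∫ τ(g)⁻¹ f(g) dg`. -/
def twistedAverage (τ : PontryaginDual G) : C(G, A) →L[ℂ] A :=
  LinearMap.mkContinuous
    { toFun := fun f => ∫ g, ((τ⁻¹ g : Circle) : ℂ) • f g ∂μ
      map_add' := fun f h => by
        rw [← integral_add (integrable_char_smul μ _ f) (integrable_char_smul μ _ h)]
        simp only [ContinuousMap.add_apply, smul_add]
      map_smul' := fun c f => by
        rw [RingHom.id_apply, ← integral_smul]
        simp only [ContinuousMap.smul_apply, smul_comm c] }
    1 fun f => by
      rw [one_mul]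
      simpa using norm_integral_le_of_norm_le_const (μ := μ) (C := ‖f‖)
        (f := fun g => ((τ⁻¹ g : Circle) : ℂ) • f g) (Filter.Eventually.of_forall fun g => by
          rw [norm_smul, Circle.norm_coe, one_mul]
          exact f.norm_coe_le_norm g)

theorem twistedAverage_apply (τ : PontryaginDual G) (f : C(G, A)) :
    twistedAverage μ τ f = ∫ g, ((τ⁻¹ g : Circle) : ℂ) • f g ∂μ := rfl

/-- The spectral projection of `A` onto the `τ`-eigenspace. -/
def spectralProj (α : CStarAction G A) (τ : PontryaginDual G) : A →L[ℂ] A :=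
  (twistedAverage μ τ).comp α.coactionCLM

theorem spectralProj_apply (α : CStarAction G A) (τ : PontryaginDual G) (a : A) :
    α.spectralProj μ τ a = ∫ g, ((τ⁻¹ g : Circle) : ℂ) • α.toHom g a ∂μ := rfl

/-- Left invariance allows `h * g` in place of `g` in the average, which pulls out the factor `τ h`.
-/
theorem spectralProj_mem [IsTopologicalGroup G] [μ.IsMulLeftInvariant] (α : CStarAction G A) (τ : PontryaginDual G) (a : A) :
    α.spectralProj μ τ a ∈ α.eigenspace τ := by
  intro h
  have hint : Integrable (fun g => ((τ⁻¹ g : Circle) : ℂ) • α.toHom g a) μ :=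
    integrable_char_smul μ τ⁻¹ (α.coaction a)
  rw [spectralProj_apply]
  change α.toCLM h _ = _
  rw [← ContinuousLinearMap.integral_comp_comm _ hint,
    ← integral_mul_left_eq_self (fun g => ((τ⁻¹ g : Circle) : ℂ) • α.toHom g a) h, ← integral_smul]
  refine integral_congr_ae (Filter.Eventually.of_forall fun g => ?_)
  change α.toHom h (_ • α.toHom g a) = _
  simp only [map_mul, map_smul, PontryaginDual.inv_apply, Circle.coe_mul, smul_smul,
    StarAlgEquiv.mul_apply]
  rw [← mul_assoc, ← Circle.coe_mul, mul_inv_cancel, Circle.coe_one, one_mul]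

theorem spectralProj_of_mem {α : CStarAction G A} {τ : PontryaginDual G} {a : A}
    (ha : a ∈ α.eigenspace τ) : α.spectralProj μ τ a = a := by
  have : ∀ g, ((τ⁻¹ g : Circle) : ℂ) • α.toHom g a = a := fun g => by
    rw [ha g, smul_smul, ← Circle.coe_mul, PontryaginDual.inv_apply, inv_mul_cancel,
      Circle.coe_one, one_smul]
  simp [spectralProj_apply, this]

/-- Orthogonality of characters without evaluating an integral: the average is a scalar multiple of
`a`, so it lies in both eigenspaces and vanishes. -/
theorem spectralProj_of_mem_of_ne [IsTopologicalGroup G] [μ.IsMulLeftInvariant]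
    {α : CStarAction G A} {τ η : PontryaginDual G} (hne : τ ≠ η) {a : A} (ha : a ∈ α.eigenspace η) : α.spectralProj μ τ a = 0 := by
  refine eq_zero_of_mem_eigenspace_of_ne hne (α.spectralProj_mem μ τ a) ?_
  have : α.spectralProj μ τ a = (∫ g, ((τ⁻¹ g : Circle) : ℂ) * ((η g : Circle) : ℂ) ∂μ) • a := by
    rw [← integral_smul_const, spectralProj_apply]
    refine integral_congr_ae (Filter.Eventually.of_forall fun g => ?_)
    simp only [ha g, smul_smul]
  rw [this]
  exact Submodule.smul_mem _ _ ha

/-- The factor `η g` coming from `b` merges with the weight `τ⁻¹ g`. For `τ = 1` this turns an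
arbitrary left factor into one of degree `η⁻¹`. -/
theorem spectralProj_mul_of_mem {α : CStarAction G A} {τ η : PontryaginDual G} {a b : A}
    (hb : b ∈ α.eigenspace η) :
    α.spectralProj μ τ (a * b) = α.spectralProj μ (τ * η⁻¹) a * b := by
  have hint : Integrable (fun g => (((τ * η⁻¹)⁻¹ g : Circle) : ℂ) • α.toHom g a) μ :=
    integrable_char_smul μ (τ * η⁻¹)⁻¹ (α.coaction a)
  rw [spectralProj_apply, spectralProj_apply]
  change _ = (ContinuousLinearMap.mul ℂ A).flip b _
  rw [← ContinuousLinearMap.integral_comp_comm _ hint]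
  refine integral_congr_ae (Filter.Eventually.of_forall fun g => ?_)
  have hη : (τ * η⁻¹)⁻¹ = η * τ⁻¹ := by rw [mul_inv, inv_inv, mul_comm]
  rw [hη]
  simp only [map_mul, hb g, ContinuousLinearMap.flip_apply,
    ContinuousLinearMap.mul_apply', smul_mul_assoc, mul_smul_comm, smul_smul,
    PontryaginDual.mul_apply, Circle.coe_mul, mul_comm]

theorem twistedAverage_const_mul (τ : PontryaginDual G) (a : A) (f : C(G, A)) :
    twistedAverage μ τ (ContinuousMap.const G a * f) = a * twistedAverage μ τ f := by
  rw [twistedAverage_apply, twistedAverage_apply]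
  change _ = ContinuousLinearMap.mul ℂ A a _
  rw [← ContinuousLinearMap.integral_comp_comm _ (integrable_char_smul μ τ⁻¹ f)]
  refine integral_congr_ae (Filter.Eventually.of_forall fun g => ?_)
  simp

/-- A free action is saturated. -/
theorem IsFree.isSaturated [IsTopologicalGroup G] [μ.IsMulLeftInvariant] {α : CStarAction G A}
    (h : α.IsFree) : α.IsSaturated := by
  intro τ
  have hone : {a : A | ∀ g, α.toHom g a = a} = α.eigenspace 1 :=
    Set.ext fun a => mem_eigenspace_one.symm
  rw [hone]
  refine Set.Subset.antisymm
    (closure_minimal (α.span_star_mul_le τ) (α.isClosed_eigenspace 1)) fun b hb => ?_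
  set K := Submodule.span ℂ (Set.image2 (fun a b => star a * b)
      (α.eigenspace τ : Set A) (α.eigenspace τ : Set A))
  -- `T` sends `a ρ(c)` to `E_{τ⁻¹}(a) E_τ(c)`, a product in `B_τ^* B_τ`, and sends `τ ⊗ b` back to
  -- `b`.
  let T : C(G, A) →L[ℂ] A := (α.spectralProj μ 1).comp (twistedAverage μ τ)
  have hT : Submodule.span ℂ (Set.range fun x : A × A =>
      ContinuousMap.const G x.1 * α.coaction x.2) ≤ K.comap (T : C(G, A) →ₗ[ℂ] A) := by
    refine Submodule.span_le.2 ?_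
    rintro _ ⟨⟨a, c⟩, rfl⟩
    change α.spectralProj μ 1 (twistedAverage μ τ (ContinuousMap.const G a * α.coaction c)) ∈ K
    rw [twistedAverage_const_mul]
    have hc := α.spectralProj_mem μ τ c
    change α.spectralProj μ 1 (a * α.spectralProj μ τ c) ∈ K
    rw [spectralProj_mul_of_mem μ hc, one_mul]
    refine Submodule.subset_span ⟨star (α.spectralProj μ τ⁻¹ a), ?_, _, hc, by simp⟩
    simpa using star_mem_eigenspace (α.spectralProj_mem μ τ⁻¹ a)
  have hTb : T (τ.toContinuousMap • ContinuousMap.const G b) = b := by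
    have h1 : twistedAverage μ τ (τ.toContinuousMap • ContinuousMap.const G b) = b := by
      have : ∀ g, ((τ⁻¹ g : Circle) : ℂ) • (τ.toContinuousMap • ContinuousMap.const G b) g = b :=
        fun g => by
          change ((τ⁻¹ g : Circle) : ℂ) • ((τ g : Circle) : ℂ) • b = b
          rw [smul_smul, ← Circle.coe_mul, PontryaginDual.inv_apply, inv_mul_cancel,
            Circle.coe_one, one_smul]
      simp only [twistedAverage_apply, this, integral_const, probReal_univ, one_smul]
    change α.spectralProj μ 1 (twistedAverage μ τ _) = b
    rw [h1, spectralProj_of_mem μ hb]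
  rw [← hTb]
  exact map_mem_closure T.continuous (h _) hT

end Projection

/-- The spectral projections show that the eigenspaces are independent. -/
theorem iSupIndep_eigenspace [CompactSpace G] [MeasurableSpace G] [BorelSpace G]
    [IsTopologicalGroup G] (μ : Measure G) [IsProbabilityMeasure μ] [μ.IsMulLeftInvariant]
    (α : CStarAction G A) : iSupIndep α.eigenspace := by
  intro τ
  rw [Submodule.disjoint_def]
  intro x hx hx'
  have hle : ⨆ η, ⨆ (_ : η ≠ τ), α.eigenspace η ≤
      LinearMap.ker (α.spectralProj μ τ : A →ₗ[ℂ] A) :=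
    iSup₂_le fun η hη y hy => spectralProj_of_mem_of_ne μ hη.symm hy
  rw [← spectralProj_of_mem μ hx]
  exact hle hx'

/-- If the characters separate points and, for each character `τ`, all functions
`g ↦ τ(g) c` with `c` in a dense set are limits of sums of functions `g ↦ a α_g(b)`, then the
action is free. -/
theorem isFree_of_char_smul_mem [CompactSpace G] [T2Space G] {α : CStarAction G A}
    (hsep : ∀ g h : G, g ≠ h → ∃ τ : PontryaginDual G, τ g ≠ τ h) {D : Set A} (hD : Dense D)
    (h : ∀ τ : PontryaginDual G, ∀ c ∈ D, τ.toContinuousMap • ContinuousMap.const G c ∈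
      Submodule.span ℂ (Set.range fun x : A × A =>
        ContinuousMap.const G x.1 * α.coaction x.2)) : α.IsFree := by
  set W := Submodule.span ℂ (Set.range fun x : A × A =>
        ContinuousMap.const G x.1 * α.coaction x.2)
  suffices hW : W.topologicalClosure = ⊤ by
    intro f
    change f ∈ W.topologicalClosure
    rw [hW]; trivial
  refine ContinuousMap.eq_top_of_smul_const_mem _ W.isClosed_topologicalClosure fun φ a => ?_
  -- Density is used once in each tensor factor: from `D` to all `a` here, then from characters to
  -- all `φ`.
  have h1 : ∀ τ : PontryaginDual G,
      τ.toContinuousMap • ContinuousMap.const G a ∈ W.topologicalClosure := fun τ =>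
    map_mem_closure (f := ContinuousMap.smulConst G A τ.toContinuousMap)
      (ContinuousMap.smulConst G A τ.toContinuousMap).continuous (hD a) (h τ)
  let R : C(G, ℂ) →L[ℂ] C(G, A) := (ContinuousMap.smulConst G A).flip a
  have h2 : Submodule.span ℂ (Set.range (PontryaginDual.toContinuousMap (G := G))) ≤
      W.topologicalClosure.comap (R : C(G, ℂ) →ₗ[ℂ] C(G, A)) :=
    Submodule.span_le.2 (by rintro _ ⟨τ, rfl⟩; exact h1 τ)
  have hφ : φ ∈ closure (Submodule.span ℂ
      (Set.range (PontryaginDual.toContinuousMap (G := G))) : Set C(G, ℂ)) := by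
    have := PontryaginDual.span_range_toContinuousMap_closure hsep
    change φ ∈ (Submodule.span ℂ
      (Set.range (PontryaginDual.toContinuousMap (G := G)))).topologicalClosure
    rw [this]; trivial
  have h3 := map_mem_closure (t := (W.topologicalClosure : Set C(G, A))) R.continuous hφ h2
  rwa [W.isClosed_topologicalClosure.closure_eq] at h3

end

end CStarAction

/-! ### Monomials in the graph algebra -/

namespace DirGraph

noncomputable section

open MeasureTheory

variable {V : Type u} {E : Type v}

namespace IsCKFamily

variable {Γ : DirGraph V E} {A : Type w} [NonUnitalCStarAlgebra A] {P : V → A} {S : E → A}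

theorem P_mul_self (h : Γ.IsCKFamily P S) (v : V) : P v * P v = P v :=
  (h.proj v).isIdempotentElem

theorem star_P (h : Γ.IsCKFamily P S) (v : V) : star (P v) = P v :=
  (h.proj v).isSelfAdjoint

/-- By the C*-identity it suffices that `x^* x = 0` for the difference `x` of the two sides, and
this follows from `S e ^* S e = P (rng e)`. -/
theorem S_mul_P (h : Γ.IsCKFamily P S) (e : E) : S e * P (Γ.rng e) = S e := by
  have h0 : star (S e - S e * P (Γ.rng e)) * (S e - S e * P (Γ.rng e)) = 0 := by
    simp only [star_sub, star_mul, h.star_P, sub_mul, mul_sub, mul_assoc, h.star_mul_self,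
      h.P_mul_self, sub_self]
    rw [← mul_assoc (star (S e)), h.star_mul_self, h.P_mul_self, h.P_mul_self, sub_self, sub_zero]
  exact (sub_eq_zero.1 ((CStarRing.star_mul_self_eq_zero_iff _).1 h0)).symm

theorem P_mul_S_of_ne (h : Γ.IsCKFamily P S) {v : V} {e : E} (hv : v ≠ Γ.src e) :
    P v * S e = 0 := by
  rw [← h.range_le e, ← mul_assoc, h.orthogonal _ _ hv, zero_mul]

theorem star_S_mul_S_of_ne (h : Γ.IsCKFamily P S) {e f : E} (hef : e ≠ f) :
    star (S e) * S f = 0 := by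
  by_cases hs : Γ.src e = Γ.src f
  · exact h.ranges_orthogonal e f hs hef
  · rw [← h.range_le e, star_mul, h.star_P, mul_assoc, h.P_mul_S_of_ne hs, mul_zero]

end IsCKFamily

/-- The product `s_{e₁} ⋯ s_{eₙ} p_v`, for a list of edges `e₁, …, eₙ` and a vertex `v`. -/
def pathElt (Γ : DirGraph V E) (v : V) : List E → Γ.GraphCStar
  | [] => Γ.p v
  | e :: μ => Γ.s e * Γ.pathElt v μ

/-- The monomial `s_μ p_v s_ν^*`. -/
def monomial (Γ : DirGraph V E) (v : V) (μ ν : List E) : Γ.GraphCStar :=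
  Γ.pathElt v μ * star (Γ.pathElt v ν)

variable (Γ : DirGraph V E)

theorem pathElt_nil (v : V) : Γ.pathElt v [] = Γ.p v := rfl

theorem pathElt_cons (v : V) (e : E) (μ : List E) :
    Γ.pathElt v (e :: μ) = Γ.s e * Γ.pathElt v μ := rfl

theorem pathElt_mul_p (v : V) (μ : List E) : Γ.pathElt v μ * Γ.p v = Γ.pathElt v μ := by
  induction μ with
  | nil => exact Γ.isCKFamily_graphCStar.P_mul_self v
  | cons e μ ih => rw [pathElt_cons, mul_assoc, ih]

/-- The lists need not be composable paths. This dichotomy replaces any test of composability. -/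
theorem p_mul_pathElt (u v : V) (μ : List E) :
    Γ.p u * Γ.pathElt v μ = 0 ∨ Γ.p u * Γ.pathElt v μ = Γ.pathElt v μ := by
  cases μ with
  | nil =>
    by_cases h : u = v
    · subst h; exact Or.inr (Γ.isCKFamily_graphCStar.P_mul_self u)
    · exact Or.inl (Γ.isCKFamily_graphCStar.orthogonal u v h)
  | cons e μ =>
    rw [pathElt_cons, ← mul_assoc]
    by_cases h : u = Γ.src e
    · subst h; exact Or.inr (by rw [Γ.isCKFamily_graphCStar.range_le])
    · exact Or.inl (by rw [Γ.isCKFamily_graphCStar.P_mul_S_of_ne h, zero_mul])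

theorem exists_p_mul_pathElt (v : V) (μ : List E) :
    ∃ u, Γ.p u * Γ.pathElt v μ = Γ.pathElt v μ := by
  cases μ with
  | nil => exact ⟨v, Γ.isCKFamily_graphCStar.P_mul_self v⟩
  | cons e μ =>
    exact ⟨Γ.src e, by rw [pathElt_cons, ← mul_assoc, Γ.isCKFamily_graphCStar.range_le]⟩

theorem pathElt_append {v w : V} {κ : List E} (h : Γ.p v * Γ.pathElt w κ = Γ.pathElt w κ)
    (μ : List E) : Γ.pathElt w (μ ++ κ) = Γ.pathElt v μ * Γ.pathElt w κ := by
  induction μ with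
  | nil => exact h.symm
  | cons e μ ih => rw [List.cons_append, pathElt_cons, ih, pathElt_cons, mul_assoc]

/-- Leading edges cancel pairwise through `s_e^* s_e = p_{r(e)}` until two of them differ, which
gives zero, or one list is exhausted and the rest `κ` of the other remains. -/
theorem star_pathElt_mul_pathElt (v w : V) (ν μ : List E) :
    star (Γ.pathElt v ν) * Γ.pathElt w μ = 0 ∨
    (∃ κ, μ = ν ++ κ ∧ star (Γ.pathElt v ν) * Γ.pathElt w μ = Γ.pathElt w κ) ∨
    (∃ κ, ν = μ ++ κ ∧ star (Γ.pathElt v ν) * Γ.pathElt w μ = star (Γ.pathElt v κ)) := by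
  have C := Γ.isCKFamily_graphCStar
  induction ν generalizing μ with
  | nil =>
    rw [pathElt_nil, C.star_P]
    rcases Γ.p_mul_pathElt v w μ with h | h
    · exact Or.inl h
    · exact Or.inr (Or.inl ⟨μ, rfl, h⟩)
  | cons e ν ih =>
    cases μ with
    | nil =>
      have hs : star (Γ.pathElt v (e :: ν)) * Γ.pathElt w [] =
          star (Γ.p w * Γ.pathElt v (e :: ν)) := by rw [star_mul, C.star_P, pathElt_nil]
      rw [hs]
      rcases Γ.p_mul_pathElt w v (e :: ν) with h | h
      · exact Or.inl (by rw [h, star_zero])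
      · exact Or.inr (Or.inr ⟨e :: ν, rfl, by rw [h]⟩)
    | cons f μ =>
      have hs : star (Γ.pathElt v (e :: ν)) * Γ.pathElt w (f :: μ) =
          star (Γ.pathElt v ν) * ((star (Γ.s e) * Γ.s f) * Γ.pathElt w μ) := by
        simp only [pathElt_cons, star_mul, mul_assoc]
      by_cases hef : e = f
      · subst hef
        rw [C.star_mul_self] at hs
        rcases Γ.p_mul_pathElt (Γ.rng e) w μ with h | h
        · exact Or.inl (by rw [hs, h, mul_zero])
        · rw [hs, h]
          rcases ih μ with h0 | ⟨κ, rfl, h1⟩ | ⟨κ, rfl, h2⟩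
          · exact Or.inl h0
          · exact Or.inr (Or.inl ⟨κ, rfl, h1⟩)
          · exact Or.inr (Or.inr ⟨κ, rfl, h2⟩)
      · exact Or.inl (by rw [hs, C.star_S_mul_S_of_ne hef, zero_mul, mul_zero])

theorem star_monomial (v : V) (μ ν : List E) :
    star (Γ.monomial v μ ν) = Γ.monomial v ν μ := by
  rw [monomial, monomial, star_mul, star_star]

theorem p_eq_monomial (v : V) : Γ.p v = Γ.monomial v [] [] := by
  rw [monomial, pathElt_nil, Γ.isCKFamily_graphCStar.star_P, Γ.isCKFamily_graphCStar.P_mul_self]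

theorem s_eq_monomial (e : E) : Γ.s e = Γ.monomial (Γ.rng e) [e] [] := by
  rw [monomial, pathElt_cons, pathElt_nil, Γ.isCKFamily_graphCStar.star_P, mul_assoc,
    Γ.isCKFamily_graphCStar.P_mul_self, Γ.isCKFamily_graphCStar.S_mul_P]

/-- The product of two monomials vanishes or is a monomial, obtained by appending a list of edges
to the outer list of the factor with the shorter inner list. -/
theorem monomial_mul_monomial (v w : V) (μ ν μ' ν' : List E) :
    Γ.monomial v μ ν * Γ.monomial w μ' ν' = 0 ∨
    (∃ κ, μ' = ν ++ κ ∧ Γ.monomial v μ ν * Γ.monomial w μ' ν' = Γ.monomial w (μ ++ κ) ν') ∨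
    (∃ κ, ν = μ' ++ κ ∧ Γ.monomial v μ ν * Γ.monomial w μ' ν' = Γ.monomial v μ (ν' ++ κ)) := by
  have hs : Γ.monomial v μ ν * Γ.monomial w μ' ν' =
      Γ.pathElt v μ * (star (Γ.pathElt v ν) * Γ.pathElt w μ') * star (Γ.pathElt w ν') := by
    simp only [monomial, mul_assoc]
  rw [hs]
  rcases Γ.star_pathElt_mul_pathElt v w ν μ' with h | ⟨κ, hκ, h⟩ | ⟨κ, hκ, h⟩
  · exact Or.inl (by rw [h, mul_zero, zero_mul])
  · rw [h]
    -- The factor `Γ.p v` at the end of `Γ.pathElt v μ` decides whether `κ` can be attached there.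
    rcases Γ.p_mul_pathElt v w κ with h0 | h0
    · exact Or.inl (by rw [← Γ.pathElt_mul_p v μ, mul_assoc (Γ.pathElt v μ), h0, mul_zero,
        zero_mul])
    · exact Or.inr (Or.inl ⟨κ, hκ, by rw [monomial, Γ.pathElt_append h0]⟩)
  · rw [h]
    rcases Γ.p_mul_pathElt w v κ with h0 | h0
    · refine Or.inl ?_
      rw [mul_assoc, ← star_mul, ← Γ.pathElt_mul_p w ν', mul_assoc (Γ.pathElt w ν'), h0, mul_zero,
        star_zero, mul_zero]
    · exact Or.inr (Or.inr ⟨κ, hκ, by rw [monomial, Γ.pathElt_append h0, star_mul, mul_assoc]⟩)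

/-- The set of all monomials. -/
def monomials : Set Γ.GraphCStar := {x | ∃ v μ ν, Γ.monomial v μ ν = x}

theorem mul_mem_monomials {x y : Γ.GraphCStar} (hx : x ∈ Γ.monomials) (hy : y ∈ Γ.monomials) :
    x * y = 0 ∨ x * y ∈ Γ.monomials := by
  obtain ⟨v, μ, ν, rfl⟩ := hx
  obtain ⟨w, μ', ν', rfl⟩ := hy
  rcases Γ.monomial_mul_monomial v w μ ν μ' ν' with h | ⟨κ, _, h⟩ | ⟨κ, _, h⟩
  · exact Or.inl h
  · exact Or.inr ⟨_, _, _, h.symm⟩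
  · exact Or.inr ⟨_, _, _, h.symm⟩

/-- The vertex projections serve as local units, since `C*(Γ)` need not have a unit. -/
theorem exists_mul_p_of_mem_monomials {x : Γ.GraphCStar} (hx : x ∈ Γ.monomials) :
    ∃ u, x * Γ.p u = x := by
  obtain ⟨v, μ, ν, rfl⟩ := hx
  obtain ⟨u, hu⟩ := Γ.exists_p_mul_pathElt v ν
  refine ⟨u, ?_⟩
  rw [monomial, mul_assoc, ← Γ.isCKFamily_graphCStar.star_P u, ← star_mul, hu]

theorem p_mem_leavitt (v : V) : Γ.p v ∈ Γ.leavitt :=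
  NonUnitalStarAlgebra.subset_adjoin ℂ _ (Or.inl ⟨v, rfl⟩)

theorem s_mem_leavitt (e : E) : Γ.s e ∈ Γ.leavitt :=
  NonUnitalStarAlgebra.subset_adjoin ℂ _ (Or.inr ⟨e, rfl⟩)

theorem pathElt_mem_leavitt (v : V) (μ : List E) : Γ.pathElt v μ ∈ Γ.leavitt := by
  induction μ with
  | nil => exact Γ.p_mem_leavitt v
  | cons e μ ih => exact mul_mem (Γ.s_mem_leavitt e) ih

theorem monomials_subset_leavitt : Γ.monomials ⊆ Γ.leavitt := by
  rintro _ ⟨v, μ, ν, rfl⟩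
  exact mul_mem (Γ.pathElt_mem_leavitt v μ) (star_mem (Γ.pathElt_mem_leavitt v ν))

/-- `L(Γ)` as a subspace of `C*(Γ)`. -/
abbrev leavittSubmodule : Submodule ℂ Γ.GraphCStar :=
  Γ.leavitt.toNonUnitalSubalgebra.toSubmodule

theorem mul_mem_span_of_mul_mem {A : Type*} [NonUnitalRing A] [Module ℂ A]
    [IsScalarTower ℂ A A] [SMulCommClass ℂ A A] {s t : Set A} {N : Submodule ℂ A}
    (h : ∀ x ∈ s, ∀ y ∈ t, x * y ∈ N) {x y : A} (hx : x ∈ Submodule.span ℂ s)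
    (hy : y ∈ Submodule.span ℂ t) : x * y ∈ N := by
  induction hx using Submodule.span_induction with
  | zero => rw [zero_mul]; exact N.zero_mem
  | add a b _ _ ha hb => rw [add_mul]; exact N.add_mem ha hb
  | smul c a _ ha => rw [smul_mul_assoc]; exact N.smul_mem c ha
  | mem a ha =>
    induction hy using Submodule.span_induction with
    | zero => rw [mul_zero]; exact N.zero_mem
    | add b c _ _ hb hc => rw [mul_add]; exact N.add_mem hb hc
    | smul c b _ hb => rw [mul_smul_comm]; exact N.smul_mem c hb
    | mem b hb => exact h a ha b hb

/-- The Leavitt path algebra is spanned by the monomials. -/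
theorem leavittSubmodule_eq_span : Γ.leavittSubmodule = Submodule.span ℂ Γ.monomials := by
  refine le_antisymm ?_ (Submodule.span_le.2 Γ.monomials_subset_leavitt)
  intro x hx
  change x ∈ NonUnitalStarAlgebra.adjoin ℂ (Set.range Γ.p ∪ Set.range Γ.s) at hx
  induction hx using NonUnitalStarAlgebra.adjoin_induction with
  | mem y hy =>
    rcases hy with ⟨v, rfl⟩ | ⟨e, rfl⟩
    · exact Submodule.subset_span ⟨v, [], [], (Γ.p_eq_monomial v).symm⟩
    · exact Submodule.subset_span ⟨_, [e], [], (Γ.s_eq_monomial e).symm⟩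
  | add a b _ _ ha hb => exact Submodule.add_mem _ ha hb
  | zero => exact Submodule.zero_mem _
  | mul a b _ _ ha hb =>
    refine mul_mem_span_of_mul_mem (fun x hx y hy => ?_) ha hb
    rcases Γ.mul_mem_monomials hx hy with h | h
    · rw [h]; exact Submodule.zero_mem _
    · exact Submodule.subset_span h
  | smul c a _ ha => exact Submodule.smul_mem _ c ha
  | star a haL ha =>
    clear haL
    induction ha using Submodule.span_induction with
    | mem x hx =>
      obtain ⟨v, μ, ν, rfl⟩ := hx
      exact Submodule.subset_span ⟨v, ν, μ, (Γ.star_monomial v μ ν).symm⟩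
    | zero => rw [star_zero]; exact Submodule.zero_mem _
    | add a b _ _ ha hb => rw [star_add]; exact Submodule.add_mem _ ha hb
    | smul c a _ ha => rw [star_smul]; exact Submodule.smul_mem _ _ ha

/-! ### Degrees of monomials -/

section Degree

variable (G : Subgroup Circle)

/-- The inclusion of a subgroup of the circle as a character. -/
def inclChar : PontryaginDual G :=
  (⟨G.subtype, continuous_subtype_val⟩ : G →ₜ* Circle)

theorem p_mem_eigenspace (v : V) : Γ.p v ∈ (Γ.gaugeAction G).eigenspace 1 :=
  CStarAction.mem_eigenspace_one.2 fun _ => rfl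

theorem s_mem_eigenspace (e : E) : Γ.s e ∈ (Γ.gaugeAction G).eigenspace (inclChar G) :=
  fun g => Γ.gaugeHom_s g e

theorem pathElt_mem_eigenspace (v : V) (μ : List E) :
    Γ.pathElt v μ ∈ (Γ.gaugeAction G).eigenspace (inclChar G ^ μ.length) := by
  induction μ with
  | nil => exact Γ.p_mem_eigenspace G v
  | cons e μ ih =>
    rw [List.length_cons, pow_succ']
    exact CStarAction.mul_mem_eigenspace (Γ.s_mem_eigenspace G e) ih

theorem monomial_mem_eigenspace (v : V) (μ ν : List E) : Γ.monomial v μ ν ∈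
    (Γ.gaugeAction G).eigenspace (inclChar G ^ μ.length * (inclChar G ^ ν.length)⁻¹) :=
  CStarAction.mul_mem_eigenspace (Γ.pathElt_mem_eigenspace G v μ)
    (CStarAction.star_mem_eigenspace (Γ.pathElt_mem_eigenspace G v ν))

/-- `exp(iπ/n)` has `n`-th power `-1`, so the character has infinite order. Hence the full circle,
unlike a finite `G`, detects whether `|μ| = |ν|` on nonzero monomials. -/
theorem inclChar_top_pow_injective : Function.Injective fun n : ℕ => inclChar ⊤ ^ n := by
  rw [injective_pow_iff_not_isOfFinOrder, isOfFinOrder_iff_pow_eq_one]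
  rintro ⟨n, hn, h⟩
  have h1 : (Circle.exp (Real.pi / n)) ^ n = 1 :=
    (PontryaginDual.pow_apply (inclChar ⊤) n ⟨_, trivial⟩).symm.trans <|
      DFunLike.congr_fun h (⟨Circle.exp (Real.pi / n), trivial⟩ : (⊤ : Subgroup Circle))
  rw [← Circle.exp_nsmul, nsmul_eq_mul, mul_div_cancel₀ _ (by positivity)] at h1
  have h2 := congrArg (fun z : Circle => (z : ℂ)) h1
  norm_num [Circle.coe_exp] at h2

end Degree

end

end DirGraph

/-! ### Finite-dimensional algebras of balanced monomials -/

/-- In a normed algebra, an element of a finite-dimensional subalgebra that is close to an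
idempotent `q` of the subalgebra, and fixed by `q`, has a right inverse relative to `q`. -/
theorem exists_mul_eq_of_norm_sub_lt_one {A : Type*} [NonUnitalNormedRing A] [NormedSpace ℂ A]
    [IsScalarTower ℂ A A] [SMulCommClass ℂ A A] (W : Submodule ℂ A) [FiniteDimensional ℂ W]
    (hW : ∀ a ∈ W, ∀ b ∈ W, a * b ∈ W) {q y : A} (hq : q ∈ W) (hqq : q * q = q) (hy : y ∈ W)
    (hqy : q * y = y) (hlt : ‖q - y‖ < 1) : ∃ w ∈ W, y * w = q := by
  -- On `U = {w ∈ W | q w = w}`, left multiplication by `y` is injective: `y w = 0` gives `w = (q -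
  -- y) w`, which forces `w = 0`. By finite dimension it is onto, so it hits `q`.
  let U : Submodule ℂ A := W ⊓ LinearMap.eqLocus (LinearMap.mulLeft ℂ q) LinearMap.id
  have hU : ∀ w ∈ U, LinearMap.mulLeft ℂ y w ∈ U := fun w hw =>
    ⟨hW y hy w hw.1, by
      change q * (y * w) = y * w
      rw [← mul_assoc, hqy]⟩
  have : FiniteDimensional ℂ U := Submodule.finiteDimensional_of_le (inf_le_left : U ≤ W)
  let ℓ : U →ₗ[ℂ] U := (LinearMap.mulLeft ℂ y).restrict hU
  have hinj : Function.Injective ℓ := by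
    rw [← LinearMap.ker_eq_bot, LinearMap.ker_eq_bot']
    intro w hw
    have h0 : y * (w : A) = 0 := congrArg Subtype.val hw
    have h1 : q * (w : A) = w := w.2.2
    have h2 : ‖(w : A)‖ ≤ ‖q - y‖ * ‖(w : A)‖ := by
      calc ‖(w : A)‖ = ‖(q - y) * (w : A)‖ := by rw [sub_mul, h0, h1, sub_zero]
        _ ≤ _ := norm_mul_le _ _
    have h3 : ‖(w : A)‖ = 0 := by nlinarith [norm_nonneg (w : A)]
    exact Subtype.ext (norm_eq_zero.1 h3)
  obtain ⟨w, hw⟩ := LinearMap.surjective_of_injective hinj ⟨q, hq, hqq⟩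
  exact ⟨w, w.2.1, congrArg Subtype.val hw⟩

namespace DirGraph

noncomputable section

open MeasureTheory

variable {V : Type u} {E : Type v} (Γ : DirGraph V E)

/-- The monomials `s_μ p_v s_ν^*` with `μ` and `ν` of equal length. -/
def balancedMonomials : Set Γ.GraphCStar :=
  {x | ∃ v μ ν, μ.length = ν.length ∧ Γ.monomial v μ ν = x}

/-- The balanced monomials with a bounded length and restricted vertices and edges. -/
def boundedMonomials (F : Set V) (H : Set E) (n : ℕ) : Set Γ.GraphCStar :=
  {x | ∃ v ∈ F, ∃ μ ν, μ.length = ν.length ∧ μ.length ≤ n ∧ (∀ e ∈ μ, e ∈ H) ∧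
    (∀ e ∈ ν, e ∈ H) ∧ Γ.monomial v μ ν = x}

theorem boundedMonomials_mono {F F' : Set V} {H H' : Set E} {n n' : ℕ} (hF : F ⊆ F')
    (hH : H ⊆ H') (hn : n ≤ n') : Γ.boundedMonomials F H n ⊆ Γ.boundedMonomials F' H' n' := by
  rintro x ⟨v, hv, μ, ν, h, hl, hμ, hν, rfl⟩
  exact ⟨v, hF hv, μ, ν, h, hl.trans hn, fun e he => hH (hμ e he), fun e he => hH (hν e he), rfl⟩

theorem boundedMonomials_finite {F : Set V} {H : Set E} (hF : F.Finite) (hH : H.Finite) (n : ℕ) :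
    (Γ.boundedMonomials F H n).Finite := by
  have : Finite H := hH
  have hT : {μ : List E | μ.length ≤ n ∧ ∀ e ∈ μ, e ∈ H}.Finite := by
    refine ((List.finite_length_le H n).image (List.map Subtype.val)).subset ?_
    rintro μ ⟨hl, hμ⟩
    lift μ to List H using hμ
    exact ⟨μ, by simpa using hl, rfl⟩
  refine ((hF.prod (hT.prod hT)).image fun x => Γ.monomial x.1 x.2.1 x.2.2).subset ?_
  rintro x ⟨v, hv, μ, ν, h, hl, hμ, hν, rfl⟩
  exact ⟨(v, μ, ν), ⟨hv, ⟨hl, hμ⟩, h ▸ hl, hν⟩, rfl⟩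

/-- Balance is essential here: a nonzero product of balanced monomials is balanced, its length is
the larger of the two lengths, and no new edges or vertices appear. -/
theorem mul_mem_span_boundedMonomials {F : Set V} {H : Set E} {n : ℕ} {x y : Γ.GraphCStar}
    (hx : x ∈ Submodule.span ℂ (Γ.boundedMonomials F H n))
    (hy : y ∈ Submodule.span ℂ (Γ.boundedMonomials F H n)) :
    x * y ∈ Submodule.span ℂ (Γ.boundedMonomials F H n) := by
  refine mul_mem_span_of_mul_mem (fun x hx y hy => ?_) hx hy
  obtain ⟨v, hv, μ, ν, h, hl, hμ, hν, rfl⟩ := hx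
  obtain ⟨w, hw, μ', ν', h', hl', hμ', hν', rfl⟩ := hy
  rcases Γ.monomial_mul_monomial v w μ ν μ' ν' with h0 | ⟨κ, rfl, h0⟩ | ⟨κ, rfl, h0⟩
  · rw [h0]; exact Submodule.zero_mem _
  · rw [h0]
    refine Submodule.subset_span ⟨w, hw, _, _, ?_, ?_, ?_, hν', rfl⟩
    · rw [← h', List.length_append, List.length_append, h]
    · rw [List.length_append, h, ← List.length_append]; exact hl'
    · intro e he
      rcases List.mem_append.1 he with he | he
      · exact hμ e he
      · exact hμ' e (List.mem_append_right _ he)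
  · rw [h0]
    refine Submodule.subset_span ⟨v, hv, _, _, ?_, hl, hμ, ?_, rfl⟩
    · rw [h, List.length_append, List.length_append, h']
    · intro e he
      rcases List.mem_append.1 he with he | he
      · exact hν' e he
      · exact hν e (List.mem_append_right _ he)

theorem exists_mem_span_boundedMonomials {y : Γ.GraphCStar}
    (hy : y ∈ Submodule.span ℂ Γ.balancedMonomials) : ∃ (F : Set V) (H : Set E) (n : ℕ),
      F.Finite ∧ H.Finite ∧ y ∈ Submodule.span ℂ (Γ.boundedMonomials F H n) := by
  induction hy using Submodule.span_induction with
  | mem x hx =>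
    obtain ⟨v, μ, ν, h, rfl⟩ := hx
    refine ⟨{v}, {e | e ∈ μ} ∪ {e | e ∈ ν}, μ.length, Set.finite_singleton v,
      (List.finite_toSet μ).union (List.finite_toSet ν), Submodule.subset_span ?_⟩
    exact ⟨v, rfl, μ, ν, h, le_rfl, fun e he => Or.inl he, fun e he => Or.inr he, rfl⟩
  | zero => exact ⟨∅, ∅, 0, Set.finite_empty, Set.finite_empty, Submodule.zero_mem _⟩
  | add a b _ _ ha hb =>
    obtain ⟨F, H, n, hF, hH, ha⟩ := ha
    obtain ⟨F', H', n', hF', hH', hb⟩ := hb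
    refine ⟨F ∪ F', H ∪ H', max n n', hF.union hF', hH.union hH', Submodule.add_mem _
      (Submodule.span_mono (Γ.boundedMonomials_mono ?_ ?_ (le_max_left _ _)) ha)
      (Submodule.span_mono (Γ.boundedMonomials_mono ?_ ?_ (le_max_right _ _)) hb)⟩
    exacts [Set.subset_union_left, Set.subset_union_left, Set.subset_union_right,
      Set.subset_union_right]
  | smul c a _ ha =>
    obtain ⟨F, H, n, hF, hH, ha⟩ := ha
    exact ⟨F, H, n, hF, hH, Submodule.smul_mem _ c ha⟩

/-- An element of the span of the balanced monomials that is close to a vertex projection, and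
fixed by it, has a right inverse relative to it within this span. -/
theorem exists_mul_eq_p {y : Γ.GraphCStar} (hy : y ∈ Submodule.span ℂ Γ.balancedMonomials) {v : V}
    (hpy : Γ.p v * y = y) (hlt : ‖Γ.p v - y‖ < 1) :
    ∃ w ∈ Submodule.span ℂ Γ.balancedMonomials, y * w = Γ.p v := by
  obtain ⟨F, H, n, hF, hH, hyW⟩ := Γ.exists_mem_span_boundedMonomials hy
  -- Adding `v` puts `p_v`, the monomial with two empty lists, into the algebra.
  let W := Submodule.span ℂ (Γ.boundedMonomials (insert v F) H n)
  have : FiniteDimensional ℂ W :=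
    FiniteDimensional.span_of_finite ℂ (Γ.boundedMonomials_finite (hF.insert v) hH n)
  obtain ⟨w, hw, h⟩ := exists_mul_eq_of_norm_sub_lt_one W
    (fun a ha b hb => Γ.mul_mem_span_boundedMonomials ha hb)
    (Submodule.subset_span ⟨v, Set.mem_insert v F, [], [], rfl, Nat.zero_le n, by simp, by simp,
      (Γ.p_eq_monomial v).symm⟩)
    (Γ.isCKFamily_graphCStar.P_mul_self v)
    (Submodule.span_mono (Γ.boundedMonomials_mono (Set.subset_insert v F) subset_rfl le_rfl) hyW)
    hpy hlt
  refine ⟨w, Submodule.span_mono ?_ hw, h⟩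
  rintro x ⟨v, -, μ, ν, h, -, -, -, rfl⟩
  exact ⟨v, μ, ν, h, rfl⟩

theorem p_mul_mem_span_balancedMonomials (v : V) {y : Γ.GraphCStar}
    (hy : y ∈ Submodule.span ℂ Γ.balancedMonomials) :
    Γ.p v * y ∈ Submodule.span ℂ Γ.balancedMonomials := by
  refine mul_mem_span_of_mul_mem (s := {Γ.p v}) ?_ (Submodule.mem_span_singleton_self _) hy
  rintro _ rfl _ ⟨w, μ, ν, h, rfl⟩
  rw [monomial, ← mul_assoc]
  rcases Γ.p_mul_pathElt v w μ with h0 | h0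
  · rw [h0, zero_mul]; exact Submodule.zero_mem _
  · rw [h0]; exact Submodule.subset_span ⟨w, μ, ν, h, rfl⟩

/-- The homogeneous component `L_τ` of the Leavitt path algebra, as a subspace of `C*(Γ)`. -/
def leavittEigenspace (G : Subgroup Circle) (τ : PontryaginDual G) : Submodule ℂ Γ.GraphCStar :=
  Γ.leavittSubmodule ⊓ (Γ.gaugeAction G).eigenspace τ

/-- The linear span of the products of elements of `L_τ` and `L_η`. -/
def leavittMul (G : Subgroup Circle) (τ η : PontryaginDual G) : Submodule ℂ Γ.GraphCStar :=
  Submodule.span ℂ (Set.image2 (fun a b => a * b)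
    (Γ.leavittEigenspace G τ : Set Γ.GraphCStar) (Γ.leavittEigenspace G η))

/-! ### Homogeneous components of the Leavitt path algebra -/

section Grading

variable {G : Subgroup Circle}

theorem mul_mem_leavittEigenspace {τ η : PontryaginDual G} {a b : Γ.GraphCStar}
    (ha : a ∈ Γ.leavittEigenspace G τ) (hb : b ∈ Γ.leavittEigenspace G η) :
    a * b ∈ Γ.leavittEigenspace G (τ * η) :=
  ⟨Γ.leavitt.mul_mem ha.1 hb.1, CStarAction.mul_mem_eigenspace ha.2 hb.2⟩

theorem star_mem_leavittEigenspace {τ : PontryaginDual G} {a : Γ.GraphCStar}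
    (ha : a ∈ Γ.leavittEigenspace G τ) : star a ∈ Γ.leavittEigenspace G τ⁻¹ :=
  ⟨Γ.leavitt.star_mem' ha.1, CStarAction.star_mem_eigenspace ha.2⟩

theorem p_mem_leavittEigenspace (v : V) : Γ.p v ∈ Γ.leavittEigenspace G 1 :=
  ⟨Γ.p_mem_leavitt v, Γ.p_mem_eigenspace G v⟩

theorem span_balancedMonomials_le :
    Submodule.span ℂ Γ.balancedMonomials ≤ Γ.leavittEigenspace G 1 := by
  refine Submodule.span_le.2 ?_
  rintro _ ⟨v, μ, ν, h, rfl⟩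
  refine ⟨Γ.monomials_subset_leavitt ⟨v, μ, ν, rfl⟩, ?_⟩
  have := Γ.monomial_mem_eigenspace G v μ ν
  rwa [h, mul_inv_cancel] at this

theorem leavittMul_le (τ η : PontryaginDual G) :
    Γ.leavittMul G τ η ≤ Γ.leavittEigenspace G (τ * η) := by
  refine Submodule.span_le.2 ?_
  rintro _ ⟨a, ha, b, hb, rfl⟩
  exact Γ.mul_mem_leavittEigenspace ha hb

/-- With `σ = 1`, this and `mul_mem_leavittMul_left` make `L_{τ⁻¹} L_τ` a two-sided ideal of `L_1`.
-/
theorem mul_mem_leavittMul {τ η σ : PontryaginDual G} {x y : Γ.GraphCStar}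
    (hx : x ∈ Γ.leavittMul G τ η) (hy : y ∈ Γ.leavittEigenspace G σ) :
    x * y ∈ Γ.leavittMul G τ (η * σ) := by
  refine mul_mem_span_of_mul_mem (t := {y}) ?_ hx (Submodule.mem_span_singleton_self y)
  rintro _ ⟨a, ha, b, hb, rfl⟩ _ rfl
  exact Submodule.subset_span ⟨a, ha, b * _, Γ.mul_mem_leavittEigenspace hb hy, (mul_assoc _ _ _).symm⟩

theorem mul_mem_leavittMul_left {τ η σ : PontryaginDual G} {x y : Γ.GraphCStar}
    (hx : x ∈ Γ.leavittEigenspace G σ) (hy : y ∈ Γ.leavittMul G τ η) :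
    x * y ∈ Γ.leavittMul G (σ * τ) η := by
  refine mul_mem_span_of_mul_mem (s := {x}) ?_ (Submodule.mem_span_singleton_self x) hy
  rintro _ rfl _ ⟨a, ha, b, hb, rfl⟩
  exact Submodule.subset_span ⟨_ * a, Γ.mul_mem_leavittEigenspace hx ha, b, hb, mul_assoc _ _ _⟩

/-- Monomials are homogeneous, so each is kept or killed. This is why the spectral projections
preserve `L(Γ)`. -/
theorem spectralProj_mem_of_monomial [CompactSpace G] [MeasurableSpace G] [BorelSpace G]
    (μ : Measure G) [IsProbabilityMeasure μ] [μ.IsMulLeftInvariant] (τ : PontryaginDual G)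
    {x : Γ.GraphCStar} (hx : x ∈ Γ.monomials) :
    (Γ.gaugeAction G).spectralProj μ τ x = 0 ∨
      (Γ.gaugeAction G).spectralProj μ τ x = x ∧ x ∈ (Γ.gaugeAction G).eigenspace τ := by
  obtain ⟨v, κ, ν, rfl⟩ := hx
  have h := Γ.monomial_mem_eigenspace G v κ ν
  by_cases hτ : τ = inclChar G ^ κ.length * (inclChar G ^ ν.length)⁻¹
  · rw [← hτ] at h
    exact Or.inr ⟨CStarAction.spectralProj_of_mem μ h, h⟩
  · exact Or.inl (CStarAction.spectralProj_of_mem_of_ne μ hτ h)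

theorem spectralProj_mem_span [CompactSpace G] [MeasurableSpace G] [BorelSpace G]
    (μ : Measure G) [IsProbabilityMeasure μ] [μ.IsMulLeftInvariant] (τ : PontryaginDual G)
    {x : Γ.GraphCStar} (hx : x ∈ Γ.leavittSubmodule) : (Γ.gaugeAction G).spectralProj μ τ x ∈
      Submodule.span ℂ (Γ.monomials ∩ Γ.leavittEigenspace G τ) := by
  rw [leavittSubmodule_eq_span] at hx
  have hle : Submodule.span ℂ Γ.monomials ≤
      (Submodule.span ℂ (Γ.monomials ∩ Γ.leavittEigenspace G τ)).comap
        ((Γ.gaugeAction G).spectralProj μ τ : Γ.GraphCStar →ₗ[ℂ] Γ.GraphCStar) := by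
    refine Submodule.span_le.2 fun m hm => ?_
    rw [SetLike.mem_coe, Submodule.mem_comap, ContinuousLinearMap.coe_coe]
    rcases Γ.spectralProj_mem_of_monomial μ τ hm with h | ⟨h, hm'⟩
    · rw [h]; exact Submodule.zero_mem _
    · rw [h]; exact Submodule.subset_span ⟨hm, Γ.monomials_subset_leavitt hm, hm'⟩
  exact hle hx

/-- The homogeneous components of the Leavitt path algebra are spanned by monomials. -/
theorem leavittEigenspace_eq_span [CompactSpace G] [MeasurableSpace G] [BorelSpace G]
    (μ : Measure G) [IsProbabilityMeasure μ] [μ.IsMulLeftInvariant] (τ : PontryaginDual G) :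
    Γ.leavittEigenspace G τ = Submodule.span ℂ (Γ.monomials ∩ Γ.leavittEigenspace G τ) := by
  refine le_antisymm (fun x hx => ?_) (Submodule.span_le.2 Set.inter_subset_right)
  rw [← CStarAction.spectralProj_of_mem μ hx.2]
  exact Γ.spectralProj_mem_span μ τ hx.1

/-- The projection fixes `b`, is continuous, and maps the dense subalgebra `L(Γ)` into `L_τ`. -/
theorem eigenspace_le_closure [CompactSpace G] [MeasurableSpace G] [BorelSpace G]
    (μ : Measure G) [IsProbabilityMeasure μ] [μ.IsMulLeftInvariant] (τ : PontryaginDual G)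
    {b : Γ.GraphCStar} (hb : b ∈ (Γ.gaugeAction G).eigenspace τ) :
    b ∈ closure (Γ.leavittEigenspace G τ : Set Γ.GraphCStar) := by
  rw [← CStarAction.spectralProj_of_mem μ hb]
  refine map_mem_closure ((Γ.gaugeAction G).spectralProj μ τ).continuous (Γ.dense_leavitt b) ?_
  intro x hx
  change (Γ.gaugeAction G).spectralProj μ τ x ∈ Γ.leavittEigenspace G τ
  rw [Γ.leavittEigenspace_eq_span μ]
  exact Γ.spectralProj_mem_span μ τ hx

/-- The average over the full circle maps `L_τ L_η` to its balanced part. -/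
theorem spectralProj_one_mem_leavittMul [CompactSpace G] [MeasurableSpace G] [BorelSpace G]
    (μ : Measure G) [IsProbabilityMeasure μ] [μ.IsMulLeftInvariant]
    [CompactSpace (⊤ : Subgroup Circle)] [MeasurableSpace (⊤ : Subgroup Circle)]
    [BorelSpace (⊤ : Subgroup Circle)] (μ₀ : Measure (⊤ : Subgroup Circle))
    [IsProbabilityMeasure μ₀] [μ₀.IsMulLeftInvariant] {τ η : PontryaginDual G}
    {x : Γ.GraphCStar} (hx : x ∈ Γ.leavittMul G τ η) :
    (Γ.gaugeAction ⊤).spectralProj μ₀ 1 x ∈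
      Γ.leavittMul G τ η ⊓ Submodule.span ℂ Γ.balancedMonomials := by
  have key : ∀ y ∈ Γ.monomials, y ∈ Γ.leavittMul G τ η →
      (Γ.gaugeAction ⊤).spectralProj μ₀ 1 y ∈
        Γ.leavittMul G τ η ⊓ Submodule.span ℂ Γ.balancedMonomials := by
    intro y hy hy'
    rcases Γ.spectralProj_mem_of_monomial μ₀ 1 hy with h | ⟨h, h1⟩
    · rw [h]; exact Submodule.zero_mem _
    · rw [h]
      refine ⟨hy', ?_⟩
      obtain ⟨v, κ, ν, rfl⟩ := hy
      -- An unbalanced monomial fixed by the full circle has two different degrees, so it is zero.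
      by_cases hl : κ.length = ν.length
      · exact Submodule.subset_span ⟨v, κ, ν, hl, rfl⟩
      · have h2 := Γ.monomial_mem_eigenspace ⊤ v κ ν
        have hne : (1 : PontryaginDual (⊤ : Subgroup Circle)) ≠
            inclChar ⊤ ^ κ.length * (inclChar ⊤ ^ ν.length)⁻¹ := fun h =>
          hl (inclChar_top_pow_injective (mul_inv_eq_one.1 h.symm))
        rw [CStarAction.eq_zero_of_mem_eigenspace_of_ne hne h1 h2]
        exact Submodule.zero_mem _
  have hle : Γ.leavittMul G τ η ≤
      (Γ.leavittMul G τ η ⊓ Submodule.span ℂ Γ.balancedMonomials).comap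
        ((Γ.gaugeAction ⊤).spectralProj μ₀ 1 : Γ.GraphCStar →ₗ[ℂ] Γ.GraphCStar) := by
    refine Submodule.span_le.2 ?_
    rintro _ ⟨a, ha, b, hb, rfl⟩
    -- Both components are spanned by monomials, so `L_τ L_η` is spanned by monomials it contains.
    -- Hence the average does not leave it.
    rw [SetLike.mem_coe, Γ.leavittEigenspace_eq_span μ] at ha hb
    refine mul_mem_span_of_mul_mem (fun a ha b hb => ?_) ha hb
    rw [Submodule.mem_comap, ContinuousLinearMap.coe_coe]
    rcases Γ.mul_mem_monomials ha.1 hb.1 with h | h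
    · rw [h, map_zero]; exact Submodule.zero_mem _
    · exact key _ h (Submodule.subset_span ⟨a, ha.2, b, hb.2, rfl⟩)
  exact hle hx

/-- For a saturated gauge action the vertex projections are sums of products from `L_{τ⁻¹} L_τ`. -/
theorem p_mem_leavittMul_of_isSaturated [CompactSpace G] [MeasurableSpace G] [BorelSpace G]
    (μ : Measure G) [IsProbabilityMeasure μ] [μ.IsMulLeftInvariant]
    [CompactSpace (⊤ : Subgroup Circle)] [MeasurableSpace (⊤ : Subgroup Circle)]
    [BorelSpace (⊤ : Subgroup Circle)] (μ₀ : Measure (⊤ : Subgroup Circle))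
    [IsProbabilityMeasure μ₀] [μ₀.IsMulLeftInvariant]
    (h : (Γ.gaugeAction G).IsSaturated) (τ : PontryaginDual G) (v : V) :
    Γ.p v ∈ Γ.leavittMul G τ⁻¹ τ := by
  have h1 : Γ.p v ∈ closure (Submodule.span ℂ (Set.image2 (fun a b => star a * b)
      ((Γ.gaugeAction G).eigenspace τ : Set Γ.GraphCStar)
      ((Γ.gaugeAction G).eigenspace τ : Set Γ.GraphCStar)) : Set Γ.GraphCStar) := by
    rw [h τ]; exact fun g => rfl
  have h2 : Submodule.span ℂ (Set.image2 (fun a b => star a * b)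
      ((Γ.gaugeAction G).eigenspace τ : Set Γ.GraphCStar)
      ((Γ.gaugeAction G).eigenspace τ : Set Γ.GraphCStar)) ≤
      (Γ.leavittMul G τ⁻¹ τ).topologicalClosure := by
    refine Submodule.span_le.2 ?_
    rintro _ ⟨a, ha, b, hb, rfl⟩
    refine map_mem_closure₂ (f := fun a b => star a * b) (by fun_prop)
      (Γ.eigenspace_le_closure μ τ ha) (Γ.eigenspace_le_closure μ τ hb) ?_
    exact fun a ha b hb => Submodule.subset_span ⟨_, Γ.star_mem_leavittEigenspace ha, _, hb, rfl⟩
  have h3 : Γ.p v ∈ closure (Γ.leavittMul G τ⁻¹ τ : Set Γ.GraphCStar) :=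
    closure_minimal h2 (Submodule.isClosed_topologicalClosure _) h1
  -- `p_v` is invariant under the full circle, so averaging makes the approximants balanced without
  -- moving it.
  have h4 : Γ.p v ∈ closure ((Γ.leavittMul G τ⁻¹ τ ⊓ Submodule.span ℂ Γ.balancedMonomials :
      Submodule ℂ Γ.GraphCStar) : Set Γ.GraphCStar) := by
    rw [← CStarAction.spectralProj_of_mem μ₀ (Γ.p_mem_eigenspace ⊤ v)]
    exact map_mem_closure (ContinuousLinearMap.continuous _) h3
      fun x hx => Γ.spectralProj_one_mem_leavittMul μ μ₀ hx
  obtain ⟨x, hx, hlt⟩ := Metric.mem_closure_iff.1 h4 1 one_pos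
  have hpp := Γ.isCKFamily_graphCStar.P_mul_self v
  -- Compression by `p_v` keeps the distance below `1` and makes the approximant fixed by `p_v`.
  have hsub : Γ.p v - Γ.p v * x = Γ.p v * (Γ.p v - x) := by rw [mul_sub, hpp]
  have hlt' : ‖Γ.p v - Γ.p v * x‖ < 1 := by
    rw [hsub]
    refine (norm_mul_le _ _).trans_lt ?_
    rw [dist_eq_norm] at hlt
    have := Γ.isCKFamily_graphCStar.norm_P_le v
    nlinarith [norm_nonneg (Γ.p v - x)]
  have hbal : Γ.p v * x ∈ Submodule.span ℂ Γ.balancedMonomials := Γ.p_mul_mem_span_balancedMonomials v hx.2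
  obtain ⟨w, hw, hmul⟩ := Γ.exists_mul_eq_p hbal (by rw [← mul_assoc, hpp]) hlt'
  have hJ : Γ.p v * x ∈ Γ.leavittMul G τ⁻¹ τ := by
    simpa using Γ.mul_mem_leavittMul_left (Γ.p_mem_leavittEigenspace v) hx.1
  rw [← hmul]
  simpa using Γ.mul_mem_leavittMul hJ (Γ.span_balancedMonomials_le hw)

end Grading

end

end DirGraph

/-! ### Strong grading and freeness from the vertex projections -/

namespace DirGraph

noncomputable section

open MeasureTheory

variable {V : Type u} {E : Type v} (Γ : DirGraph V E) {G : Subgroup Circle}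

/-- The inclusion of `L(Γ)` in `C*(Γ)` as a linear map. -/
def leavittSubtype : Γ.leavitt →ₗ[ℂ] Γ.GraphCStar :=
  (NonUnitalStarSubalgebraClass.subtype Γ.leavitt : Γ.leavitt →ₗ[ℂ] Γ.GraphCStar)

theorem leavittSubtype_injective : Function.Injective Γ.leavittSubtype := Subtype.val_injective

theorem image_leavittGrading (τ : PontryaginDual G) :
    Γ.leavittSubtype '' (Γ.leavittGrading G τ : Set Γ.leavitt) = Γ.leavittEigenspace G τ := by
  ext x
  constructor
  · rintro ⟨y, hy, rfl⟩
    exact ⟨y.2, hy⟩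
  · intro hx
    exact ⟨⟨x, hx.1⟩, hx.2, rfl⟩

theorem map_leavittGrading (τ : PontryaginDual G) :
    (Γ.leavittGrading G τ).map Γ.leavittSubtype = Γ.leavittEigenspace G τ :=
  SetLike.coe_injective (Γ.image_leavittGrading τ)

theorem map_span_mul_leavittGrading (τ η : PontryaginDual G) :
    (Submodule.span ℂ (Set.image2 (fun a b => a * b) (Γ.leavittGrading G τ : Set Γ.leavitt)
      (Γ.leavittGrading G η : Set Γ.leavitt))).map Γ.leavittSubtype = Γ.leavittMul G τ η := by
  rw [Submodule.map_span, leavittMul, ← image_leavittGrading, ← image_leavittGrading,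
    Set.image_image2, Set.image2_image_left, Set.image2_image_right]
  rfl

theorem p_mem_leavittMul_of_isStrongGrading (h : IsStrongGrading (Γ.leavittGrading G))
    (τ : PontryaginDual G) (v : V) : Γ.p v ∈ Γ.leavittMul G τ⁻¹ τ := by
  rw [← map_span_mul_leavittGrading, h.span_mul, map_leavittGrading, inv_mul_cancel]
  exact Γ.p_mem_leavittEigenspace v

theorem isStrongGrading_of_p_mem [CompactSpace G] [MeasurableSpace G] [BorelSpace G]
    (μ : Measure G) [IsProbabilityMeasure μ] [μ.IsMulLeftInvariant]
    (h : ∀ (τ : PontryaginDual G) (v : V), Γ.p v ∈ Γ.leavittMul G τ⁻¹ τ) :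
    IsStrongGrading (Γ.leavittGrading G) where
  independent := by
    intro τ
    rw [Submodule.disjoint_def]
    intro x hx hx'
    have hle : ⨆ η, ⨆ (_ : η ≠ τ), Γ.leavittGrading G η ≤
        (⨆ η, ⨆ (_ : η ≠ τ), (Γ.gaugeAction G).eigenspace η).comap Γ.leavittSubtype :=
      iSup₂_le fun η hη y hy =>
        Submodule.mem_iSup_of_mem η (Submodule.mem_iSup_of_mem hη hy)
    exact Γ.leavittSubtype_injective (Submodule.disjoint_def.1
      ((Γ.gaugeAction G).iSupIndep_eigenspace μ τ) _ hx (hle hx'))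
  iSup_eq_top := by
    apply Submodule.map_injective_of_injective Γ.leavittSubtype_injective
    refine le_antisymm (Submodule.map_mono le_top) ?_
    rw [Submodule.map_iSup]
    rintro _ ⟨x, -, rfl⟩
    have hx : (x : Γ.GraphCStar) ∈ Γ.leavittSubmodule := x.2
    rw [leavittSubmodule_eq_span] at hx
    refine Submodule.span_le.2 ?_ hx
    rintro _ ⟨v, κ, ν, rfl⟩
    refine Submodule.mem_iSup_of_mem (inclChar G ^ κ.length * (inclChar G ^ ν.length)⁻¹) ?_
    rw [map_leavittGrading]
    exact ⟨Γ.monomials_subset_leavitt ⟨v, κ, ν, rfl⟩, Γ.monomial_mem_eigenspace G v κ ν⟩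
  span_mul τ η := by
    apply Submodule.map_injective_of_injective Γ.leavittSubtype_injective
    rw [map_span_mul_leavittGrading, map_leavittGrading]
    refine le_antisymm (Γ.leavittMul_le τ η) ?_
    rw [Γ.leavittEigenspace_eq_span μ]
    refine Submodule.span_le.2 fun x hx => ?_
    -- `x = x p_u` lies in `L_{τη} L_{η⁻¹} L_η`, which is contained in `L_τ L_η`.
    obtain ⟨u, hu⟩ := Γ.exists_mul_p_of_mem_monomials hx.1
    rw [← hu]
    simpa using Γ.mul_mem_leavittMul_left hx.2 (h η u)

theorem isFree_of_p_mem [CompactSpace G]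
    (h : ∀ (τ : PontryaginDual G) (v : V), Γ.p v ∈ Γ.leavittMul G τ⁻¹ τ) :
    (Γ.gaugeAction G).IsFree := by
  refine CStarAction.isFree_of_char_smul_mem
    (fun g g' hne => ⟨inclChar G, fun h => hne (Subtype.ext h)⟩) Γ.dense_leavitt fun τ c hc => ?_
  set W := Submodule.span ℂ (Set.range fun x : Γ.GraphCStar × Γ.GraphCStar =>
    ContinuousMap.const G x.1 * (Γ.gaugeAction G).coaction x.2)
  let R : Γ.GraphCStar →ₗ[ℂ] C(G, Γ.GraphCStar) :=
    ContinuousMap.smulConst G Γ.GraphCStar τ.toContinuousMap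
  change R c ∈ W
  -- For `b` of degree `τ`, the function `g ↦ τ(g) x a b` is exactly `(x a) ρ(b)`, so no
  -- approximation is needed.
  have hmul : ∀ x y, y ∈ Γ.leavittMul G τ⁻¹ τ → x * y ∈ W.comap R := by
    intro x y hy
    refine mul_mem_span_of_mul_mem (s := {x}) ?_ (Submodule.mem_span_singleton_self x) hy
    rintro _ hz _ ⟨a, ha, b, hb, rfl⟩
    rw [Set.mem_singleton_iff.1 hz]
    refine Submodule.subset_span ⟨(x * a, b), ?_⟩
    ext g
    change (x * a) * (Γ.gaugeAction G).toHom g b = ((τ g : Circle) : ℂ) • (x * (a * b))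
    rw [hb.2 g, mul_smul_comm, mul_assoc]
  change c ∈ Γ.leavittSubmodule at hc
  rw [leavittSubmodule_eq_span] at hc
  refine (Submodule.span_le (p := W.comap R)).2 (fun x hx => ?_) hc
  obtain ⟨u, hu⟩ := Γ.exists_mul_p_of_mem_monomials hx
  rw [← hu]
  exact hmul x _ (h τ u)

end

end DirGraph

theorem exists_invariant_probabilityMeasure (G : Type*) [Group G] [TopologicalSpace G]
    [IsTopologicalGroup G] [CompactSpace G] [MeasurableSpace G] [BorelSpace G] :
    ∃ μ : MeasureTheory.Measure G,
      MeasureTheory.IsProbabilityMeasure μ ∧ μ.IsMulLeftInvariant :=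
  ⟨MeasureTheory.Measure.haarMeasure ⊤, ⟨MeasureTheory.Measure.haarMeasure_self⟩, inferInstance⟩

theorem mainTheorem5 {V : Type u} {E : Type v} (Γ : DirGraph V E) (G : Subgroup Circle)
    (hG : IsClosed (G : Set Circle)) :
    ((Γ.gaugeAction G).IsFree ↔ IsStrongGrading (Γ.leavittGrading G)) ∧
      ((Γ.gaugeAction G).IsSaturated ↔ IsStrongGrading (Γ.leavittGrading G)) := by
  have : CompactSpace G := isCompact_iff_compactSpace.1 hG.isCompact
  have : CompactSpace (⊤ : Subgroup Circle) := isCompact_iff_compactSpace.1 isCompact_univ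
  borelize Circle
  obtain ⟨μ, _, _⟩ := exists_invariant_probabilityMeasure G
  obtain ⟨μ₀, _, _⟩ := exists_invariant_probabilityMeasure (⊤ : Subgroup Circle)
  have hfs : (Γ.gaugeAction G).IsFree → (Γ.gaugeAction G).IsSaturated := fun h => h.isSaturated μ
  have hsg : (Γ.gaugeAction G).IsSaturated → IsStrongGrading (Γ.leavittGrading G) := fun h =>
    Γ.isStrongGrading_of_p_mem μ (Γ.p_mem_leavittMul_of_isSaturated μ μ₀ h)
  have hgf : IsStrongGrading (Γ.leavittGrading G) → (Γ.gaugeAction G).IsFree := fun h =>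
    Γ.isFree_of_p_mem (Γ.p_mem_leavittMul_of_isStrongGrading h)
  exact ⟨⟨hsg ∘ hfs, hgf⟩, ⟨hsg, hfs ∘ hgf⟩⟩
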